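/- Let $SL(2,\mathbb C)$ and $K=SU(2)$ carry their topologies as subspaces of $M_2(\mathbb C)$ and their Borel $\sigma$-algebras, and for $r\in\mathbb R$ and $x\ge 1$ put $$A_r=\begin{pmatrix}e^{r/2}&0\\0&e^{-r/2}\end{pmatrix},\qquad A_x=\begin{pmatrix}x&0\\0&x^{-1}\end{pmatrix},\qquad \mathcal A^+=\{A_r: r\ge 0\}.$$ **(1)** $SL(2,\mathbb C)=K\,\mathcal A^+K$: every $g\in SL(2,\mathbb C)$ is of the form $kA_rk'$ with $k,k'\in K$, $r\ge 0$. The substitution $x=e^{r/2}$ is a bijection $[0,\infty)\to[1,\infty)$, and it turns $A_r$ into $A_x$. **(2)** Let $\mu_K,\mu_K'$ be any two Haar measures on $K$, written as $\omega_K,\omega_K'$, and consider the measures $$\omega=\sinh^2(r)\;\omega_K\wedge dr\wedge\omega_K'\ \text{ on } K\times[0,\infty)\times K,\qquad \tilde\omega=2\Big(\frac{x^2-x^{-2}}2\Big)^2x^{-1}\;\omega_K\wedge dx\wedge\omega_K'\ \text{ on } K\times[1,\infty)\times K,$$ i.e. the measures having these densities with respect to the product of $\mu_K$, Lebesgue measure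 and $\mu_K'$. Then the image of $\omega$ under $(k,r,k')\mapsto kA_rk'$ is a (left and right invariant) Haar measure on $SL(2,\mathbb C)$. It coincides with the image of $\tilde\omega$ under $(k,x,k')\mapsto kA_xk'$, and $\tilde\omega$ is the image of $\omega$ under $(k,r,k')\mapsto(k,e^{r/2},k')$. Consequently, for every Haar measure $\mu$ on $SL(2,\mathbb C)$ there is a constant $c>0$ (a normalisation) such that $\mu$ is $c$ times this image measure, and for every Borel function $f:SL(2,\mathbb C)\to\mathbb R$ (in particular every smooth one) $$\int f\,d\mu=c\int_{K\times[0,\infty)\times K}\sinh^2(r)\,f(kA_rk')\;d\mu_K(k)\,dr\,d\mu_K'(k') =c\int_{K\times[1,\infty)\times K}2\Big(\frac{x^2-x^{-2}}2\Big)^2x^{-1}f(kA_xk')\;d\mu_K(k)\,dx\,d\mu_K'(k'),$$ where the integrands of all three integrals are integrable as soon as one of them is. **(3)** Let $\mathfrak k=\mathfrak{su}(2)$ (traceless antihermitian matrices), let $\mathfrak a$ be the space of real diagonal traceless matrices, and let $\sigma_x,\sigma_y,\sigma_z$ be the Pauli matrices. For every $r\in\mathbb R$ the map $$\varphi_r:\mathfrak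 k\oplus\mathfrak a\oplus\mathfrak k\to SL(2,\mathbb C)\subset M_2(\mathbb C),\qquad (X,Y,X')\mapsto A_r^{-1}\exp(X)\,A_r\exp(Y)\exp(X'),$$ which is the left translate by $A_r^{-1}$ of the parametrisation $(k,a,k')\mapsto kak'$ near $(1,A_r,1)$ in exponential coordinates, is differentiable at $0$. Its differential takes values in $\mathfrak{sl}(2,\mathbb C)$, the space of traceless matrices. In the basis $i\sigma_y,i\sigma_y',i\sigma_x,i\sigma_x',i\sigma_z,i\sigma_z',\sigma_z$ of $\mathfrak k\oplus\mathfrak a\oplus\mathfrak k$ (primes mark the second copy of $\mathfrak k$) and the real basis $i\sigma_y,\sigma_x,i\sigma_x,\sigma_y,i\sigma_z,\sigma_z$ of $\mathfrak{sl}(2,\mathbb C)$ its matrix is, with $c=\cosh r$ and $s=\sinh r$, $$\begin{pmatrix} c&1&0&0&0&0&0\\-s&0&0&0&0&0&0\\0&0&c&1&0&0&0\\0&0&s&0&0&0&0\\0&0&0&0&1&1&0\\0&0&0&0&0&0&1\end{pmatrix}.$$ The $6\times 6$ minor of this matrix obtained by removing the 5th or the 6th column has absolute value $\sinh^2(r)$,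 and each of the other five maximal minors is $0$. -/

import Mathlib

open MeasureTheory Matrix
open scoped ENNReal

namespace CartanSL2

noncomputable section

/-! ### The groups, with their Borel σ-algebras, and the Cartan coordinates -/

/-- The complex `2 × 2` matrices. -/
abbrev M2 : Type := Matrix (Fin 2) (Fin 2) ℂ

/-- The group `SL(2, ℂ)` with the topology of a subspace of `M₂(ℂ)`. -/
abbrev SL2C : Type := Matrix.SpecialLinearGroup (Fin 2) ℂ

/-- The group `SU(2)` with the topology of a subspace of `M₂(ℂ)`. -/
abbrev SU2 : Type := Matrix.specialUnitaryGroup (Fin 2) ℂ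

instance instMeasurableSpaceSL2C : MeasurableSpace SL2C := borel SL2C

instance instBorelSpaceSL2C : BorelSpace SL2C := ⟨rfl⟩

instance instMeasurableSpaceSU2 : MeasurableSpace SU2 := borel SU2

instance instBorelSpaceSU2 : BorelSpace SU2 := ⟨rfl⟩

/-- The inclusion of `SU(2)` into `SL(2, ℂ)`. -/
def toSL (k : SU2) : SL2C := ⟨(k : M2), k.2.2⟩

/-- `A_r = diag(e^{r/2}, e^{-r/2})`. -/
def cartanA (r : ℝ) : SL2C :=
  ⟨!![((Real.exp (r / 2) : ℝ) : ℂ), 0; 0, ((Real.exp (-(r / 2)) : ℝ) : ℂ)], by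
    rw [Matrix.det_fin_two_of, mul_zero, sub_zero, ← Complex.ofReal_mul, ← Real.exp_add,
      add_neg_cancel, Real.exp_zero, Complex.ofReal_one]⟩

/-- `A_x = diag(x, x⁻¹)` for `x ≥ 1`. -/
def cartanAx (x : Set.Ici (1 : ℝ)) : SL2C :=
  ⟨!![((x : ℝ) : ℂ), 0; 0, (((x : ℝ)⁻¹ : ℝ) : ℂ)], by
    have hx : (x : ℝ) ≠ 0 := (lt_of_lt_of_le one_pos x.2).ne'
    rw [Matrix.det_fin_two_of, mul_zero, sub_zero, ← Complex.ofReal_mul, mul_inv_cancel₀ hx,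
      Complex.ofReal_one]⟩

/-- The parametrisation `(k, r, k') ↦ k A_r k'`, for `r ≥ 0`. -/
def kak (p : SU2 × Set.Ici (0 : ℝ) × SU2) : SL2C :=
  toSL p.1 * cartanA p.2.1 * toSL p.2.2

/-- The parametrisation `(k, x, k') ↦ k A_x k'`, for `x ≥ 1`. -/
def kakx (p : SU2 × Set.Ici (1 : ℝ) × SU2) : SL2C :=
  toSL p.1 * cartanAx p.2.1 * toSL p.2.2

/-- The substitution `x = e^{r/2}`. -/
def expHalf (r : Set.Ici (0 : ℝ)) : Set.Ici (1 : ℝ) :=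
  ⟨Real.exp ((r : ℝ) / 2), Real.one_le_exp (div_nonneg r.2 zero_le_two)⟩

/-- Lebesgue measure on the ray `[a, ∞)`. -/
def lebesgueIci (a : ℝ) : Measure (Set.Ici a) := (volume : Measure ℝ).comap Subtype.val

/-- The measure `sinh²(r) · ω_K ∧ dr ∧ ω'_K` on `SU(2) × [0, ∞) × SU(2)`, where `ω_K` and `ω'_K`
stand for the measures `μ` and `μ'`. -/
def cartanMeasure (μ μ' : Measure SU2) : Measure (SU2 × Set.Ici (0 : ℝ) × SU2) :=
  (μ.prod ((lebesgueIci 0).prod μ')).withDensity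
    fun p => ENNReal.ofReal (Real.sinh (p.2.1 : ℝ) ^ 2)

/-- The measure `2 ((x² - x⁻²) / 2)² x⁻¹ · ω_K ∧ dx ∧ ω'_K` on `SU(2) × [1, ∞) × SU(2)`. -/
def cartanMeasureX (μ μ' : Measure SU2) : Measure (SU2 × Set.Ici (1 : ℝ) × SU2) :=
  (μ.prod ((lebesgueIci 1).prod μ')).withDensity
    fun p => ENNReal.ofReal
      (2 * (((p.2.1 : ℝ) ^ 2 - ((p.2.1 : ℝ) ^ 2)⁻¹) / 2) ^ 2 * (p.2.1 : ℝ)⁻¹)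

/-! ### The Lie algebras and the differential of the parametrisation -/

/-- `𝔰𝔩(2, ℂ)`, the tangent space of `SL(2, ℂ)` at `1`: traceless matrices, as a real space. -/
def sl2 : Submodule ℝ M2 where
  carrier := {X | X.trace = 0}
  add_mem' {X Y} hX hY := by
    simp only [Set.mem_ofPred_eq] at *
    rw [Matrix.trace_add, hX, hY, add_zero]
  zero_mem' := Matrix.trace_zero _ _
  smul_mem' c X hX := by
    simp only [Set.mem_ofPred_eq] at *
    rw [Matrix.trace_smul, hX, smul_zero]

/-- `𝔨 = 𝔰𝔲(2)`: antihermitian traceless matrices. -/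
def su2 : Submodule ℝ M2 where
  carrier := {X | Xᴴ = -X ∧ X.trace = 0}
  add_mem' {X Y} hX hY := by
    simp only [Set.mem_ofPred_eq] at *
    refine ⟨?_, ?_⟩
    · rw [Matrix.conjTranspose_add, hX.1, hY.1, neg_add]
    · rw [Matrix.trace_add, hX.2, hY.2, add_zero]
  zero_mem' := ⟨by simp, Matrix.trace_zero _ _⟩
  smul_mem' c X hX := by
    simp only [Set.mem_ofPred_eq] at *
    refine ⟨?_, ?_⟩
    · rw [Matrix.conjTranspose_smul, hX.1, star_trivial, smul_neg]
    · rw [Matrix.trace_smul, hX.2, smul_zero]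

/-- `𝔞`: real diagonal traceless matrices. -/
def diagA : Submodule ℝ M2 where
  carrier := {X | (∃ v : Fin 2 → ℝ, X = Matrix.diagonal fun i => (v i : ℂ)) ∧ X.trace = 0}
  add_mem' {X Y} hX hY := by
    simp only [Set.mem_ofPred_eq] at *
    obtain ⟨⟨v, rfl⟩, hX⟩ := hX
    obtain ⟨⟨w, rfl⟩, hY⟩ := hY
    refine ⟨⟨v + w, ?_⟩, ?_⟩
    · rw [Matrix.diagonal_add]; simp
    · rw [Matrix.trace_add, hX, hY, add_zero]
  zero_mem' := ⟨⟨0, by simp⟩, Matrix.trace_zero _ _⟩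
  smul_mem' c X hX := by
    simp only [Set.mem_ofPred_eq] at *
    obtain ⟨⟨v, rfl⟩, hX⟩ := hX
    refine ⟨⟨c • v, ?_⟩, ?_⟩
    · ext i j; fin_cases i <;> fin_cases j <;> simp
    · rw [Matrix.trace_smul, hX, smul_zero]

/-- The Pauli matrices `σ_x`, `σ_y`, `σ_z`. -/
def σx : M2 := !![0, 1; 1, 0]

def σy : M2 := !![0, -Complex.I; Complex.I, 0]

def σz : M2 := !![1, 0; 0, -1]

/-- `φ_r : 𝔨 ⊕ 𝔞 ⊕ 𝔨 → SL(2, ℂ) ⊆ M₂(ℂ)`,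
`(K, A, K') ↦ A_r⁻¹ · exp K · A_r · exp A · exp K'`: the left translate by `A_r⁻¹` of the
parametrisation `(k, a, k') ↦ k a k'` around `(1, A_r, 1)`, in exponential coordinates. -/
def phi (r : ℝ) (p : su2 × diagA × su2) : M2 :=
  ((cartanA r)⁻¹ : SL2C).1 * NormedSpace.exp (p.1 : M2) * (cartanA r).1 *
    NormedSpace.exp (p.2.1 : M2) * NormedSpace.exp (p.2.2 : M2)

/-- `iσ_x` as an element of `𝔰𝔲(2)`. -/
def kx : su2 := ⟨Complex.I • σx, by
  refine ⟨?_, ?_⟩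
  · ext i j; fin_cases i <;> fin_cases j <;> simp [σx]
  · simp [σx, Matrix.trace_fin_two]⟩

/-- `iσ_y` as an element of `𝔰𝔲(2)`. -/
def ky : su2 := ⟨Complex.I • σy, by
  refine ⟨?_, ?_⟩
  · ext i j; fin_cases i <;> fin_cases j <;> simp [σy]
  · simp [σy, Matrix.trace_fin_two]⟩

/-- `iσ_z` as an element of `𝔰𝔲(2)`. -/
def kz : su2 := ⟨Complex.I • σz, by
  refine ⟨?_, ?_⟩
  · ext i j; fin_cases i <;> fin_cases j <;> simp [σz]
  · simp [σz, Matrix.trace_fin_two]⟩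

/-- `σ_z` as an element of `𝔞`. -/
def az : diagA := ⟨σz, by
  refine ⟨⟨![1, -1], ?_⟩, ?_⟩
  · ext i j; fin_cases i <;> fin_cases j <;> simp [σz]
  · simp [σz, Matrix.trace_fin_two]⟩

/-- `iσ_y, iσ_y', iσ_x, iσ_x', iσ_z, iσ_z', σ_z` in `𝔨 ⊕ 𝔞 ⊕ 𝔨`; a prime marks the second copy
of `𝔨`. -/
def domVec : Fin 7 → su2 × diagA × su2 :=
  ![(ky, 0, 0), (0, 0, ky), (kx, 0, 0), (0, 0, kx), (kz, 0, 0), (0, 0, kz), (0, az, 0)]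

lemma trace_pauli : ∀ i : Fin 6,
    (![Complex.I • σy, σx, Complex.I • σx, σy, Complex.I • σz, σz] i) ∈ sl2 := by
  intro i
  change Matrix.trace _ = 0
  fin_cases i <;> simp [σx, σy, σz, Matrix.trace_fin_two]

/-- `iσ_y, σ_x, iσ_x, σ_y, iσ_z, σ_z` in `𝔰𝔩(2, ℂ)`. -/
def codVec (i : Fin 6) : sl2 :=
  ⟨![Complex.I • σy, σx, Complex.I • σx, σy, Complex.I • σz, σz] i, trace_pauli i⟩

lemma su2_eq (X : su2) : X = (X.1 0 1).im • kx + (X.1 0 1).re • ky + (X.1 0 0).im • kz := by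
  obtain ⟨X, h, ht⟩ := X
  have h00 := congrFun (congrFun h 0) 0
  have h10 := congrFun (congrFun h 1) 0
  rw [Matrix.trace_fin_two] at ht
  simp only [Matrix.conjTranspose_apply, Matrix.neg_apply, Complex.ext_iff, Complex.star_def,
    Complex.conj_re, Complex.conj_im, Complex.neg_re, Complex.neg_im, Complex.add_re,
    Complex.add_im, Complex.zero_re, Complex.zero_im] at h00 h10 ht
  apply Subtype.ext
  ext i j
  fin_cases i <;> fin_cases j <;>
    simp [kx, ky, kz, σx, σy, σz, Complex.ext_iff] <;> (try constructor) <;> linarith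

lemma diagA_eq (X : diagA) : X = (X.1 0 0).re • az := by
  obtain ⟨X, ⟨v, rfl⟩, ht⟩ := X
  rw [Matrix.trace_fin_two] at ht
  simp only [Matrix.diagonal_apply_eq, Complex.ext_iff, Complex.add_re, Complex.ofReal_re,
    Complex.zero_re] at ht
  apply Subtype.ext
  ext i j
  fin_cases i <;> fin_cases j <;> simp [az, σz, Complex.ext_iff]
  linarith [ht.1]

lemma sl2_eq (X : sl2) :
    X = (((X.1 0 1).re - (X.1 1 0).re) / 2) • codVec 0
      + (((X.1 0 1).re + (X.1 1 0).re) / 2) • codVec 1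
      + (((X.1 0 1).im + (X.1 1 0).im) / 2) • codVec 2
      + (((X.1 1 0).im - (X.1 0 1).im) / 2) • codVec 3
      + (X.1 0 0).im • codVec 4 + (X.1 0 0).re • codVec 5 := by
  obtain ⟨X, ht⟩ := X
  change Matrix.trace X = 0 at ht
  rw [Matrix.trace_fin_two] at ht
  simp only [Complex.ext_iff, Complex.add_re, Complex.add_im, Complex.zero_re,
    Complex.zero_im] at ht
  apply Subtype.ext
  ext i j
  fin_cases i <;> fin_cases j <;>
    simp [codVec, σx, σy, σz, Complex.ext_iff] <;> (try constructor) <;> linarith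

lemma domVec_linearIndependent : LinearIndependent ℝ domVec := by
  rw [Fintype.linearIndependent_iff]
  intro g hg
  have h1 := congrArg (fun p => (p.1 : M2)) hg
  have h2 := congrArg (fun p => (p.2.1 : M2)) hg
  have h3 := congrArg (fun p => (p.2.2 : M2)) hg
  simp only [Fin.sum_univ_succ] at h1 h2 h3
  have a1 := congrFun (congrFun h1 0) 0
  have a2 := congrFun (congrFun h1 0) 1
  have a3 := congrFun (congrFun h2 0) 0
  have a4 := congrFun (congrFun h3 0) 0
  have a5 := congrFun (congrFun h3 0) 1
  simp [domVec, kx, ky, kz, az, σx, σy, σz, Complex.ext_iff] at a1 a2 a3 a4 a5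
  intro i
  fin_cases i <;> simp <;> tauto

lemma domVec_span : ⊤ ≤ Submodule.span ℝ (Set.range domVec) := by
  rintro ⟨X, A, Y⟩ -
  have key : (X, A, Y) = (X.1 0 1).re • domVec 0 + (Y.1 0 1).re • domVec 1
      + (X.1 0 1).im • domVec 2 + (Y.1 0 1).im • domVec 3
      + (X.1 0 0).im • domVec 4 + (Y.1 0 0).im • domVec 5 + (A.1 0 0).re • domVec 6 := by
    refine Prod.ext ?_ (Prod.ext ?_ ?_)
    · conv_lhs => rw [su2_eq X]
      simp [domVec]; abel
    · conv_lhs => rw [diagA_eq A]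
      simp [domVec]
    · conv_lhs => rw [su2_eq Y]
      simp [domVec]; abel
  have hm : ∀ i, domVec i ∈ Submodule.span ℝ (Set.range domVec) :=
    fun i => Submodule.subset_span ⟨i, rfl⟩
  rw [key]
  exact add_mem (add_mem (add_mem (add_mem (add_mem (add_mem (Submodule.smul_mem _ _ (hm 0))
    (Submodule.smul_mem _ _ (hm 1))) (Submodule.smul_mem _ _ (hm 2)))
    (Submodule.smul_mem _ _ (hm 3))) (Submodule.smul_mem _ _ (hm 4)))
    (Submodule.smul_mem _ _ (hm 5))) (Submodule.smul_mem _ _ (hm 6))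

lemma codVec_linearIndependent : LinearIndependent ℝ codVec := by
  rw [Fintype.linearIndependent_iff]
  intro g hg
  have h1 := congrArg (fun p : sl2 => (p : M2)) hg
  simp only [Fin.sum_univ_succ] at h1
  have a1 := congrFun (congrFun h1 0) 0
  have a2 := congrFun (congrFun h1 0) 1
  have a3 := congrFun (congrFun h1 1) 0
  simp [codVec, σx, σy, σz, Complex.ext_iff] at a1 a2 a3
  intro i
  fin_cases i <;> simp <;> linarith [a1.1, a1.2, a2.1, a2.2, a3.1, a3.2]

lemma codVec_span : ⊤ ≤ Submodule.span ℝ (Set.range codVec) := by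
  rintro X -
  have hm : ∀ i, codVec i ∈ Submodule.span ℝ (Set.range codVec) :=
    fun i => Submodule.subset_span ⟨i, rfl⟩
  rw [sl2_eq X]
  exact add_mem (add_mem (add_mem (add_mem (add_mem (Submodule.smul_mem _ _ (hm 0))
    (Submodule.smul_mem _ _ (hm 1))) (Submodule.smul_mem _ _ (hm 2)))
    (Submodule.smul_mem _ _ (hm 3))) (Submodule.smul_mem _ _ (hm 4)))
    (Submodule.smul_mem _ _ (hm 5))

/-- The basis `iσ_y, iσ_y', iσ_x, iσ_x', iσ_z, iσ_z', σ_z` of `𝔨 ⊕ 𝔞 ⊕ 𝔨`. -/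
def domBasis : Module.Basis (Fin 7) ℝ (su2 × diagA × su2) :=
  Module.Basis.mk domVec_linearIndependent domVec_span

/-- The basis `iσ_y, σ_x, iσ_x, σ_y, iσ_z, σ_z` of `𝔰𝔩(2, ℂ)`. -/
def codBasis : Module.Basis (Fin 6) ℝ sl2 :=
  Module.Basis.mk codVec_linearIndependent codVec_span

/-- The maximal minor of a `6 × 7` matrix obtained by removing the column `j`. -/
def maxMinor (J : Matrix (Fin 6) (Fin 7) ℝ) (j : Fin 7) : ℝ :=
  (J.submatrix id j.succAbove).det

end

end CartanSL2

open CartanSL2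

namespace CartanSL2

/-! ### Topology and measurable structure of `SL(2, ℂ)` and `SU(2)` -/

/-! The density is found without a Jacobian of the Cartan parametrisation, by computing the law of
one function under an explicit Haar measure. Left and right multiplication by `SL(2, ℂ)` preserve
both Lebesgue measure on `M₂(ℂ)` and the determinant. Restricting Lebesgue measure to `1 ≤ |det| ≤
2` and dividing each matrix by a square root of its determinant therefore yields a bi-invariant Haar
measure, `shellMeasure`.

By `kak_surjective` every `g` is `k A_r k'`, and its squared Frobenius norm is `2 cosh r`. So the `K
× K`-orbits are the level sets of this norm, and the average of a function over `K × K` depends on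
the norm alone (`lintegral_kak_eq`). By bi-invariance averaging changes the integral only by the
total mass of `K × K`, so it remains to know the law of the norm under `shellMeasure`: it is a
constant times `sinh² r dr` (`exists_lintegral_normSqSL_shellMeasure`).

For that law, let `s` be the squared length of the first column and rotate this column to a multiple
of the first basis vector. If the rotated second column has squared entries `a`, `b`, then `|det|² =
s b` and the squared norm is `s + a + b`, under a multiple of `s ds da db`. With `q = s b`, `s = √q
u` and `a` rescaled by `√q`, the normalised squared norm becomes `t = u + u⁻¹ + a`. For fixed `t = 2
cosh r` the variable `u` runs over an interval of length `2 sinh r`, and `dt = 2 sinh r dr`; the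
product of the two factors is `4 sinh² r dr`.

The form in `x` is a one-variable substitution. The differential is an independent computation: the
product rule together with conjugation by `A_r`. -/

instance : SecondCountableTopology M2 :=
  inferInstanceAs (SecondCountableTopology (Fin 2 → Fin 2 → ℂ))

lemma isClosedEmbedding_SL2C :
    Topology.IsClosedEmbedding (fun g : SL2C => (fun i j => g.1 i j : Fin 2 → Fin 2 → ℂ)) :=
  Topology.IsClosedEmbedding.subtypeVal (p := fun A : M2 => A.det = 1)
    (isClosed_singleton.preimage (continuous_id.matrix_det : Continuous fun A : M2 => A.det))

lemma isClosed_SU2 : IsClosed ((Matrix.specialUnitaryGroup (Fin 2) ℂ : Set M2)) := by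
  have : (Matrix.specialUnitaryGroup (Fin 2) ℂ : Set M2) =
      {A | star A * A = 1} ∩ {A | A.det = 1} := by
    ext A
    simp [Matrix.mem_specialUnitaryGroup_iff, Matrix.mem_unitaryGroup_iff']
  rw [this]
  have h1 : Continuous fun A : M2 => star A * A :=
    (continuous_id.matrix_conjTranspose : Continuous fun A : M2 => Aᴴ).matrix_mul continuous_id
  exact (isClosed_singleton.preimage h1).inter
    (isClosed_singleton.preimage (continuous_id.matrix_det : Continuous fun A : M2 => A.det))

lemma isClosedEmbedding_SU2 :
    Topology.IsClosedEmbedding (fun g : SU2 => (fun i j => g.1 i j : Fin 2 → Fin 2 → ℂ)) :=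
  Topology.IsClosedEmbedding.subtypeVal
    (p := fun A : M2 => A ∈ Matrix.specialUnitaryGroup (Fin 2) ℂ) isClosed_SU2

instance : SecondCountableTopology SL2C :=
  isClosedEmbedding_SL2C.isEmbedding.secondCountableTopology

instance : SecondCountableTopology SU2 :=
  isClosedEmbedding_SU2.isEmbedding.secondCountableTopology

instance : LocallyCompactSpace SL2C := isClosedEmbedding_SL2C.locallyCompactSpace

instance : CompactSpace SU2 := by
  refine isCompact_univ_iff.1 (isClosedEmbedding_SU2.isCompact_iff.2 ?_)
  refine (isCompact_closedBall (0 : Fin 2 → Fin 2 → ℂ) 1).of_isClosed_subset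
    (isClosedEmbedding_SU2.isClosedMap _ isClosed_univ) ?_
  rintro _ ⟨k, -, rfl⟩
  rw [mem_closedBall_zero_iff, pi_norm_le_iff_of_nonneg zero_le_one]
  intro i
  rw [pi_norm_le_iff_of_nonneg zero_le_one]
  intro j
  exact entry_norm_bound_of_unitary k.2.1 i j

instance : IsTopologicalGroup SU2 where
  continuous_inv := by
    refine Continuous.subtype_mk ?_ _
    exact (continuous_subtype_val.matrix_conjTranspose : Continuous fun k : SU2 => (k.1)ᴴ)

lemma measurable_SL2C_iff {X : Type*} [MeasurableSpace X] {f : X → SL2C} :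
    Measurable f ↔ ∀ i j, Measurable fun x => (f x).1 i j := by
  rw [← isClosedEmbedding_SL2C.measurableEmbedding.measurable_comp_iff]
  simp only [measurable_pi_iff, Function.comp_def]

lemma continuous_toSL : Continuous toSL := by
  rw [isClosedEmbedding_SL2C.isEmbedding.continuous_iff]
  exact isClosedEmbedding_SU2.continuous

lemma continuous_SL2C_entry (i j : Fin 2) : Continuous fun g : SL2C => g.1 i j :=
  (continuous_apply_apply i j).comp isClosedEmbedding_SL2C.continuous

lemma continuous_cartanA : Continuous cartanA := by
  rw [isClosedEmbedding_SL2C.isEmbedding.continuous_iff]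
  refine continuous_pi fun i => continuous_pi fun j => ?_
  fin_cases i <;> fin_cases j <;> simp [cartanA] <;> fun_prop

lemma toSL_mul (k l : SU2) : toSL (k * l) = toSL k * toSL l := Subtype.ext rfl

lemma cartanAx_expHalf (r : Set.Ici (0 : ℝ)) : cartanAx (expHalf r) = cartanA r := by
  apply Subtype.ext
  simp [cartanAx, cartanA, expHalf, Real.exp_neg]

lemma bijective_expHalf : Function.Bijective expHalf := by
  constructor
  · intro r s h
    have := congrArg Subtype.val h
    simp only [expHalf, Real.exp_eq_exp] at this
    exact Subtype.ext (by linarith)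
  · rintro ⟨x, hx⟩
    have hx : 1 ≤ x := hx
    refine ⟨⟨2 * Real.log x, Set.mem_Ici.2 (by have := Real.log_nonneg hx; linarith)⟩, ?_⟩
    apply Subtype.ext
    simp only [expHalf]
    rw [mul_div_cancel_left₀ _ two_ne_zero, Real.exp_log (by linarith)]

lemma continuous_expHalf : Continuous expHalf := by
  refine Continuous.subtype_mk ?_ _
  fun_prop

lemma continuous_kak : Continuous kak := by
  have := continuous_toSL
  have := continuous_cartanA
  unfold kak
  fun_prop

lemma kakx_expHalf (p : SU2 × Set.Ici (0 : ℝ) × SU2) :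
    kakx (Prod.map id (Prod.map expHalf id) p) = kak p := by
  simp [kakx, kak, cartanAx_expHalf]

lemma continuous_kakx : Continuous kakx := by
  have h : Continuous cartanAx := by
    rw [isClosedEmbedding_SL2C.isEmbedding.continuous_iff]
    refine continuous_pi fun i => continuous_pi fun j => ?_
    fin_cases i <;> fin_cases j <;> simp [cartanAx] <;>
      try fun_prop
    exact (Complex.continuous_ofReal.comp continuous_subtype_val).inv₀
      fun x => Complex.ofReal_ne_zero.2 (zero_lt_one.trans_le x.2).ne'
  have := continuous_toSL
  unfold kakx
  fun_prop

/-! ### The decomposition `SL(2, ℂ) = K A⁺ K` -/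

lemma mem_SU2_iff {A : M2} :
    A ∈ Matrix.specialUnitaryGroup (Fin 2) ℂ ↔ Aᴴ * A = 1 ∧ A.det = 1 := by
  rw [Matrix.mem_specialUnitaryGroup_iff, Matrix.mem_unitaryGroup_iff', star_eq_conjTranspose]

lemma SL2C_mul_val (g h : SL2C) : (g * h).1 = g.1 * h.1 := rfl

lemma cartanA_add (r s : ℝ) : cartanA (r + s) = cartanA r * cartanA s := by
  apply Subtype.ext
  rw [SL2C_mul_val]
  ext i j
  fin_cases i <;> fin_cases j <;>
    simp [cartanA, Matrix.mul_apply, ← Complex.exp_add, add_div, add_comm]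

lemma cartanA_zero : cartanA 0 = 1 := by
  apply Subtype.ext
  ext i j
  fin_cases i <;> fin_cases j <;> simp [cartanA]

/-- A Hermitian `2 × 2` matrix is diagonalized by an element of `SU(2)`. -/
lemma exists_SU2_diagonalize {H : M2} (hH : H.IsHermitian) :
    ∃ (k : SU2) (d : Fin 2 → ℝ), (k.1)ᴴ * H * k.1 = diagonal fun i => (d i : ℂ) := by
  have hU := hH.eigenvectorUnitary.2
  have hdiag : (hH.eigenvectorUnitary.1)ᴴ * H * hH.eigenvectorUnitary.1 =
      diagonal fun i => (hH.eigenvalues i : ℂ) := by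
    have h := hH.conjStarAlgAut_star_eigenvectorUnitary
    rw [Unitary.conjStarAlgAut_apply] at h
    simpa [star_eq_conjTranspose, Function.comp_def] using h
  generalize hH.eigenvectorUnitary.1 = U at hU hdiag
  have hU' : Uᴴ * U = 1 := Matrix.mem_unitaryGroup_iff'.1 hU
  have hdet : star U.det * U.det = 1 := by
    rw [← det_conjTranspose, ← det_mul, hU', det_one]
  -- The determinant of `U` has modulus one. The diagonal unitary `E` corrects it to `1` and
  -- commutes with the diagonalised matrix.
  let E : M2 := diagonal ![star U.det, 1]
  have hE : Eᴴ * E = 1 := by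
    ext i j
    fin_cases i <;> fin_cases j <;> simp [E, Matrix.mul_apply]
    simpa [mul_comm] using hdet
  refine ⟨⟨U * E, mem_SU2_iff.2 ⟨?_, ?_⟩⟩, hH.eigenvalues, ?_⟩
  · rw [conjTranspose_mul, mul_assoc, ← mul_assoc Uᴴ, hU', one_mul, hE]
  · rw [det_mul]
    simpa [E, mul_comm] using hdet
  · have hc : Commute E (diagonal fun i => (hH.eigenvalues i : ℂ)) := by
      simp [E, Commute, SemiconjBy, diagonal_mul_diagonal, mul_comm]
    calc (U * E)ᴴ * H * (U * E) = Eᴴ * (Uᴴ * H * U) * E := by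
          simp only [conjTranspose_mul, mul_assoc]
      _ = _ := by rw [hdiag, mul_assoc, ← hc.eq, ← mul_assoc, hE, one_mul]

/-- A Hermitian `2 × 2` matrix is diagonalized by an element of `SU(2)`, with the larger eigenvalue
first. -/
lemma exists_SU2_diagonalize_sorted {H : M2} (hH : H.IsHermitian) :
    ∃ (k : SU2) (a b : ℝ), b ≤ a ∧ (k.1)ᴴ * H * k.1 = !![(a : ℂ), 0; 0, (b : ℂ)] := by
  obtain ⟨k, d, hk⟩ := exists_SU2_diagonalize hH
  rcases le_total (d 1) (d 0) with h | h
  · refine ⟨k, d 0, d 1, h, ?_⟩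
    rw [hk]
    ext i j; fin_cases i <;> fin_cases j <;> simp
  -- Conjugation by `w` swaps the two axes; the sign gives it determinant one.
  · let w : SU2 := ⟨!![0, 1; -1, 0], mem_SU2_iff.2 ⟨by
      ext i j; fin_cases i <;> fin_cases j <;> simp [Matrix.mul_apply], by
      simp [det_fin_two]⟩⟩
    refine ⟨k * w, d 1, d 0, h, ?_⟩
    calc ((k * w).1)ᴴ * H * (k * w).1 = (w.1)ᴴ * ((k.1)ᴴ * H * k.1) * w.1 := by
          simp only [Submonoid.coe_mul, conjTranspose_mul, mul_assoc]
      _ = _ := by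
          rw [hk]
          ext i j; fin_cases i <;> fin_cases j <;> simp [w, Matrix.mul_apply]

/-- Singular value decomposition. If `k` diagonalises `g* g` with eigenvalues `a ≥ b`, then `a b =
1`, so `a = e^r` and `b = e^{-r}` with `r ≥ 0`. The matrix `g k A_{-r}` is then unitary of
determinant one and serves as the left factor, with `k⁻¹` on the right. -/
theorem kak_surjective : Function.Surjective kak := by
  intro g
  obtain ⟨k, a, b, hba, hk⟩ := exists_SU2_diagonalize_sorted (isHermitian_conjTranspose_mul_self g.1)
  set m : M2 := g.1 * k.1 with hm
  have hmm : mᴴ * m = !![(a : ℂ), 0; 0, (b : ℂ)] := by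
    rw [← hk, hm]
    simp only [conjTranspose_mul, mul_assoc]
  have hdm : m.det = 1 := by rw [hm, det_mul, g.2, one_mul]; exact k.2.2
  have hab : a * b = 1 := by
    have := congrArg Matrix.det hmm
    rw [det_mul, det_conjTranspose, hdm, det_fin_two_of] at this
    simp only [star_one, mul_one, mul_zero, sub_zero] at this
    exact_mod_cast this.symm
  have ha : 0 ≤ a := by
    have := congrFun (congrFun hmm 0) 0
    simp only [Matrix.mul_apply, Fin.sum_univ_two, conjTranspose_apply, of_apply, cons_val',
      cons_val_zero, RCLike.star_def, ← Complex.normSq_eq_conj_mul_self] at this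
    norm_cast at this
    rw [← this]
    exact add_nonneg (Complex.normSq_nonneg _) (Complex.normSq_nonneg _)
  have ha1 : 1 ≤ a := by nlinarith
  set r : ℝ := Real.log a with hr
  have hr0 : 0 ≤ r := Real.log_nonneg ha1
  have hea : Real.exp r = a := Real.exp_log (by linarith)
  have heb : Real.exp (-r) = b := by
    rw [Real.exp_neg, hea]
    exact inv_eq_of_mul_eq_one_right hab
  set B : SL2C := cartanA (-r) with hB
  have hBA : B * cartanA r = 1 := by rw [hB, ← cartanA_add, neg_add_cancel, cartanA_zero]
  have hBB : (B.1)ᴴ * (mᴴ * m) * B.1 = 1 := by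
    rw [hmm, ← hea, ← heb]
    ext i j
    fin_cases i <;> fin_cases j <;>
      simp [B, cartanA, Matrix.mul_apply, -Complex.ofReal_exp]
    all_goals
      norm_cast
      rw [← Real.exp_add, ← Real.exp_add, Real.exp_eq_one_iff]
      ring
  let k1 : SU2 := ⟨m * B.1, mem_SU2_iff.2 ⟨by
    rw [← hBB]; simp only [conjTranspose_mul, mul_assoc], by rw [det_mul, hdm, B.2, one_mul]⟩⟩
  refine ⟨(k1, ⟨r, hr0⟩, k⁻¹), ?_⟩
  have h1 : toSL k1 = g * toSL k * B := Subtype.ext rfl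
  have h2 : toSL k * toSL k⁻¹ = 1 := by
    rw [← toSL_mul, mul_inv_cancel]; rfl
  change toSL k1 * cartanA r * toSL k⁻¹ = g
  rw [h1, mul_assoc (g * toSL k), hBA, mul_one, mul_assoc, h2, mul_one]

/-! ### The Frobenius norm -/

/-- The square of the Frobenius norm. -/
noncomputable def normSqSL (g : SL2C) : ℝ :=
  ‖g.1 0 0‖ ^ 2 + ‖g.1 0 1‖ ^ 2 + (‖g.1 1 0‖ ^ 2 + ‖g.1 1 1‖ ^ 2)

/-- In this form invariance under `K` on both sides follows from unitarity and cyclicity of the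
trace. -/
lemma normSqSL_eq_trace (g : SL2C) : (normSqSL g : ℂ) = ((g.1)ᴴ * g.1).trace := by
  simp only [normSqSL, trace_fin_two, Matrix.mul_apply, Fin.sum_univ_two, conjTranspose_apply,
    RCLike.star_def, ← Complex.normSq_eq_conj_mul_self, Complex.normSq_eq_norm_sq]
  push_cast
  ring

lemma normSqSL_toSL_mul (k : SU2) (g : SL2C) : normSqSL (toSL k * g) = normSqSL g := by
  rw [← Complex.ofReal_inj, normSqSL_eq_trace, normSqSL_eq_trace, SL2C_mul_val,
    conjTranspose_mul, mul_assoc, ← mul_assoc _ _ g.1]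
  have : ((toSL k).1)ᴴ * (toSL k).1 = 1 := (mem_SU2_iff.1 k.2).1
  rw [this, one_mul]

lemma normSqSL_mul_toSL (k : SU2) (g : SL2C) : normSqSL (g * toSL k) = normSqSL g := by
  rw [← Complex.ofReal_inj, normSqSL_eq_trace, normSqSL_eq_trace, SL2C_mul_val,
    conjTranspose_mul, mul_assoc, trace_mul_comm, ← mul_assoc, mul_assoc _ (toSL k).1]
  have : (toSL k).1 * ((toSL k).1)ᴴ = 1 := mul_eq_one_comm.1 (mem_SU2_iff.1 k.2).1
  rw [this, mul_one]

lemma normSqSL_cartanA (r : ℝ) : normSqSL (cartanA r) = 2 * Real.cosh r := by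
  have h : ∀ t : ℝ, Real.exp (t / 2) ^ 2 = Real.exp t := fun t => by
    rw [← Real.exp_nat_mul]; congr 1; push_cast; ring
  have h0 : normSqSL (cartanA r) = Real.exp (r / 2) ^ 2 + Real.exp (-r / 2) ^ 2 := by
    simp [normSqSL, cartanA, -Complex.ofReal_exp, Complex.norm_real, abs_of_pos (Real.exp_pos _),
      neg_div]
  rw [h0, h, h, Real.cosh_eq]
  ring

lemma measurable_normSqSL : Measurable normSqSL := by
  have := fun i j => continuous_SL2C_entry i j
  unfold normSqSL
  exact Continuous.measurable (by fun_prop)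

/-! ### A bi-invariant Haar measure on `SL(2, ℂ)` obtained from Lebesgue measure on `M₂(ℂ)` -/

lemma measurePreserving_of_abs_det {E : Type*} [NormedAddCommGroup E] [NormedSpace ℝ E]
    [MeasurableSpace E] [BorelSpace E] [FiniteDimensional ℝ E] (μ : Measure E)
    [μ.IsAddHaarMeasure] (f : E →ₗ[ℝ] E) (hf : |LinearMap.det f| = 1) :
    MeasurePreserving f μ μ := by
  refine ⟨f.continuous_of_finiteDimensional.measurable, ?_⟩
  have h0 : LinearMap.det f ≠ 0 := fun h => by simp [h] at hf
  rw [Measure.map_linearMap_addHaar_eq_smul_addHaar μ h0, abs_inv, hf]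
  simp

instance : (volume : Measure (ℂ × ℂ)).IsAddHaarMeasure :=
  Measure.prod.instIsAddHaarMeasure volume volume

instance : (volume : Measure ((ℂ × ℂ) × (ℂ × ℂ))).IsAddHaarMeasure :=
  Measure.prod.instIsAddHaarMeasure volume volume

/-- The action of `SL(2, ℂ)` on column vectors. -/
def actVec (g : SL2C) (v : ℂ × ℂ) : ℂ × ℂ :=
  (g.1 0 0 * v.1 + g.1 0 1 * v.2, g.1 1 0 * v.1 + g.1 1 1 * v.2)

/-- The real determinant of a complex-linear map is the norm from `ℂ` to `ℝ` of its complex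
determinant, here `1`. -/
lemma measurePreserving_actVec (g : SL2C) : MeasurePreserving (actVec g) := by
  let f : ℂ × ℂ →ₗ[ℂ] ℂ × ℂ :=
    Matrix.toLin (Module.Basis.finTwoProd ℂ) (Module.Basis.finTwoProd ℂ) g.1
  have hf : ⇑(f.restrictScalars ℝ) = actVec g := by
    funext v
    change f v = _
    simp only [f]
    rw [Matrix.eta_fin_two g.1, Matrix.toLin_finTwoProd_apply]
    simp [actVec]
  rw [← hf]
  have hdet : LinearMap.det f = 1 := by
    rw [LinearMap.det_toLin]; exact g.2
  refine measurePreserving_of_abs_det (E := ℂ × ℂ) volume (f.restrictScalars ℝ) ?_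
  rw [LinearMap.det_restrictScalars, hdet]
  simp

/-- The determinant of the matrix with given columns. -/
def colDet (p : (ℂ × ℂ) × (ℂ × ℂ)) : ℂ := p.1.1 * p.2.2 - p.2.1 * p.1.2

/-- The left action of `SL(2, ℂ)` on matrices, given by their columns. -/
def actLeft (g : SL2C) : (ℂ × ℂ) × (ℂ × ℂ) → (ℂ × ℂ) × (ℂ × ℂ) := Prod.map (actVec g) (actVec g)

/-- Transposition of matrices given by their columns. -/
noncomputable def colTranspose : (ℂ × ℂ) × (ℂ × ℂ) →ₗ[ℝ] (ℂ × ℂ) × (ℂ × ℂ) where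
  toFun p := ((p.1.1, p.2.1), (p.1.2, p.2.2))
  map_add' _ _ := rfl
  map_smul' _ _ := rfl

/-- An involution has determinant `±1`. -/
lemma measurePreserving_colTranspose : MeasurePreserving colTranspose := by
  refine measurePreserving_of_abs_det (E := (ℂ × ℂ) × (ℂ × ℂ)) volume _ ?_
  have h : colTranspose * colTranspose = 1 := by
    ext <;> simp [colTranspose]
  have h2 := congrArg LinearMap.det h
  rw [map_mul, map_one] at h2
  rcases mul_self_eq_one_iff.1 h2 with h | h <;> simp [h]

lemma measurePreserving_actLeft (g : SL2C) : MeasurePreserving (actLeft g) :=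
  (measurePreserving_actVec g).prod (measurePreserving_actVec g)

/-- The right action of `SL(2, ℂ)` on matrices, given by their columns. -/
noncomputable def actRight (g : SL2C) (p : (ℂ × ℂ) × (ℂ × ℂ)) : (ℂ × ℂ) × (ℂ × ℂ) :=
  colTranspose (actLeft g.transpose (colTranspose p))

lemma measurePreserving_actRight (g : SL2C) : MeasurePreserving (actRight g) :=
  measurePreserving_colTranspose.comp
    ((measurePreserving_actLeft _).comp measurePreserving_colTranspose)

lemma colDet_actLeft (g : SL2C) (p : (ℂ × ℂ) × (ℂ × ℂ)) : colDet (actLeft g p) = colDet p := by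
  have h : g.1 0 0 * g.1 1 1 - g.1 0 1 * g.1 1 0 = 1 := by rw [← det_fin_two]; exact g.2
  simp only [colDet, actLeft, actVec, Prod.map]
  linear_combination (p.1.1 * p.2.2 - p.2.1 * p.1.2) * h

lemma colDet_colTranspose (p : (ℂ × ℂ) × (ℂ × ℂ)) : colDet (colTranspose p) = colDet p := by
  simp only [colDet, colTranspose, LinearMap.coe_mk, AddHom.coe_mk]
  ring

lemma colDet_actRight (g : SL2C) (p : (ℂ × ℂ) × (ℂ × ℂ)) : colDet (actRight g p) = colDet p := by
  rw [actRight, colDet_colTranspose, colDet_actLeft, colDet_colTranspose]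

lemma measurable_colDet : Measurable colDet := by unfold colDet; fun_prop

/-- An inverse square root of the determinant. -/
noncomputable def colScale (p : (ℂ × ℂ) × (ℂ × ℂ)) : ℂ := colDet p ^ (-(1 / 2) : ℂ)

lemma colScale_sq {p : (ℂ × ℂ) × (ℂ × ℂ)} (hp : colDet p ≠ 0) :
    colScale p * colScale p * colDet p = 1 := by
  rw [colScale, ← Complex.cpow_add _ _ hp]
  norm_num
  rw [Complex.cpow_neg_one, inv_mul_cancel₀ hp]

/-- The normalization of a matrix to determinant one. -/
noncomputable def colNormalize (p : (ℂ × ℂ) × (ℂ × ℂ)) : SL2C :=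
  open Classical in
  if hp : colDet p ≠ 0 then
    ⟨!![colScale p * p.1.1, colScale p * p.2.1; colScale p * p.1.2, colScale p * p.2.2], by
      rw [det_fin_two_of, ← colScale_sq hp, colDet]; ring⟩
  -- The value at singular matrices is immaterial, since they lie outside the shell.
  else 1

lemma colNormalize_val {p : (ℂ × ℂ) × (ℂ × ℂ)} (hp : colDet p ≠ 0) : (colNormalize p).1 =
    !![colScale p * p.1.1, colScale p * p.2.1; colScale p * p.1.2, colScale p * p.2.2] := by
  have h : colNormalize p = ⟨_, _⟩ := dif_pos hp
  rw [h]

lemma measurable_colNormalize : Measurable colNormalize := by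
  have hD : MeasurableSet {p | colDet p ≠ 0} :=
    (measurable_colDet (measurableSet_singleton 0)).compl
  have hs : Measurable colScale := measurable_colDet.pow_const _
  refine measurable_of_restrict_of_restrict_compl hD ?_ ?_
  · rw [measurable_SL2C_iff]
    intro i j
    have : (fun p : {p | colDet p ≠ 0} => (Set.domRestrict {p | colDet p ≠ 0} colNormalize p).1 i j) =
        fun p => (!![colScale p.1 * p.1.1.1, colScale p.1 * p.1.2.1;
          colScale p.1 * p.1.1.2, colScale p.1 * p.1.2.2] : M2) i j := by
      funext p
      exact congrFun (congrFun (colNormalize_val p.2) i) j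
    rw [this]
    fin_cases i <;> fin_cases j <;> simp <;> fun_prop
  · have : Set.domRestrict {p | colDet p ≠ 0}ᶜ colNormalize = fun _ => 1 := by
      funext p
      exact dif_neg p.2
    rw [this]
    exact measurable_const

/-- The branch of the square root does no harm: `colScale` depends on the determinant alone, which
the action preserves, so the same root occurs on both sides. -/
lemma colNormalize_actLeft (g : SL2C) {p : (ℂ × ℂ) × (ℂ × ℂ)} (hp : colDet p ≠ 0) :
    colNormalize (actLeft g p) = g * colNormalize p := by
  have hp' : colDet (actLeft g p) ≠ 0 := by rwa [colDet_actLeft]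
  apply Subtype.ext
  rw [SL2C_mul_val, colNormalize_val hp, colNormalize_val hp', colScale, colDet_actLeft, ← colScale]
  ext i j
  fin_cases i <;> fin_cases j <;> simp [Matrix.mul_apply, actLeft, actVec] <;> ring

lemma colNormalize_actRight (g : SL2C) {p : (ℂ × ℂ) × (ℂ × ℂ)} (hp : colDet p ≠ 0) :
    colNormalize (actRight g p) = colNormalize p * g := by
  have hp' : colDet (actRight g p) ≠ 0 := by rwa [colDet_actRight]
  apply Subtype.ext
  rw [SL2C_mul_val, colNormalize_val hp, colNormalize_val hp', colScale, colDet_actRight,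
    ← colScale]
  have ht : ∀ i j, g.transpose.1 i j = g.1 j i := fun _ _ => rfl
  ext i j
  fin_cases i <;> fin_cases j <;>
    simp [Matrix.mul_apply, actLeft, actRight, colTranspose, actVec, ht] <;> ring

/-- The matrices whose determinant has absolute value between `1` and `2`. -/
def detShell : Set ((ℂ × ℂ) × (ℂ × ℂ)) := {p | ‖colDet p‖ ∈ Set.Icc (1 : ℝ) 2}

lemma measurableSet_detShell : MeasurableSet detShell :=
  measurable_colDet.norm measurableSet_Icc

lemma colDet_ne_zero_of_mem_detShell {p : (ℂ × ℂ) × (ℂ × ℂ)} (hp : p ∈ detShell) :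
    colDet p ≠ 0 :=
  norm_pos_iff.1 (zero_lt_one.trans_le hp.1)

/-- The image on `SL(2, ℂ)` of Lebesgue measure on a shell of `M₂(ℂ)`. -/
noncomputable def shellMeasure : Measure SL2C :=
  (volume.restrict detShell).map colNormalize

lemma lintegral_shellMeasure {f : SL2C → ℝ≥0∞} (hf : Measurable f) :
    ∫⁻ g, f g ∂shellMeasure = ∫⁻ p in detShell, f (colNormalize p) :=
  lintegral_map hf measurable_colNormalize

/-- Since `T` preserves the determinant it preserves the shell, and normalisation intertwines `T`
with `S`. Left and right invariance are the two instances. -/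
lemma shellMeasure_map_eq_self {T : (ℂ × ℂ) × (ℂ × ℂ) → (ℂ × ℂ) × (ℂ × ℂ)} {S : SL2C → SL2C}
    (hT : MeasurePreserving T) (hS : Measurable S) (hdet : ∀ p, colDet (T p) = colDet p)
    (h : ∀ p, colDet p ≠ 0 → colNormalize (T p) = S (colNormalize p)) :
    shellMeasure.map S = shellMeasure := by
  have hpre : T ⁻¹' detShell = detShell := by
    ext p
    simp [detShell, hdet]
  have hT' : MeasurePreserving T (volume.restrict detShell) (volume.restrict detShell) := by
    simpa only [hpre] using hT.restrict_preimage measurableSet_detShell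
  calc shellMeasure.map S = (volume.restrict detShell).map (S ∘ colNormalize) :=
        Measure.map_map hS measurable_colNormalize
    _ = (volume.restrict detShell).map (colNormalize ∘ T) := by
        refine Measure.map_congr ?_
        filter_upwards [ae_restrict_mem measurableSet_detShell] with p hp
        exact (h p (colDet_ne_zero_of_mem_detShell hp)).symm
    _ = ((volume.restrict detShell).map T).map colNormalize :=
        (Measure.map_map measurable_colNormalize hT.measurable).symm
    _ = shellMeasure := by rw [hT'.map_eq, shellMeasure]

instance : shellMeasure.IsMulLeftInvariant where
  map_mul_left_eq_self g := shellMeasure_map_eq_self (measurePreserving_actLeft g)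
    (measurable_const_mul g) (colDet_actLeft g) fun _ => colNormalize_actLeft g

instance : shellMeasure.IsMulRightInvariant where
  map_mul_right_eq_self g := shellMeasure_map_eq_self (measurePreserving_actRight g)
    (measurable_mul_const g) (colDet_actRight g) fun _ => colNormalize_actRight g

lemma norm_colScale_sq {p : (ℂ × ℂ) × (ℂ × ℂ)} (hp : colDet p ≠ 0) :
    ‖colScale p‖ ^ 2 = ‖colDet p‖⁻¹ := by
  have := congrArg norm (colScale_sq hp)
  rw [norm_mul, norm_mul, norm_one, ← sq] at this
  exact eq_inv_of_mul_eq_one_left this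

/-- The upper bound on `|det|` enters here: it bounds the scaling factor below by `1/2` (crudely),
so matrices whose normalisation has entries at most `R` have entries at most `2R`. -/
instance : IsFiniteMeasureOnCompacts shellMeasure where
  lt_top_of_isCompact K hK := by
    obtain ⟨R, hR⟩ : ∃ R : ℝ, ∀ g ∈ K, ∀ i j, ‖g.1 i j‖ ≤ R := by
      obtain ⟨R, hR⟩ := (hK.image isClosedEmbedding_SL2C.continuous).isBounded.exists_norm_le
      exact ⟨R, fun g hg i j => (norm_le_pi_norm _ j).trans
        ((norm_le_pi_norm _ i).trans (hR _ ⟨g, hg, rfl⟩))⟩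
    rw [shellMeasure, Measure.map_apply measurable_colNormalize hK.measurableSet,
      Measure.restrict_apply (measurable_colNormalize hK.measurableSet)]
    refine (measure_mono (t := Metric.closedBall 0 (2 * R)) ?_).trans_lt
      measure_closedBall_lt_top
    rintro p ⟨hpK, hp⟩
    have hp0 := colDet_ne_zero_of_mem_detShell hp
    have hs : (1 / 2 : ℝ) ≤ ‖colScale p‖ := by
      have h1 : (2 : ℝ)⁻¹ ≤ ‖colScale p‖ ^ 2 := by
        rw [norm_colScale_sq hp0]
        exact inv_anti₀ (norm_pos_iff.2 hp0) hp.2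
      nlinarith [norm_nonneg (colScale p)]
    have hb : ∀ z : ℂ, ‖colScale p * z‖ ≤ R → ‖z‖ ≤ 2 * R := fun z hz => by
      rw [norm_mul] at hz
      nlinarith [norm_nonneg z]
    have he := hR _ hpK
    rw [colNormalize_val hp0] at he
    rw [mem_closedBall_zero_iff]
    simp only [Prod.norm_def, sup_le_iff]
    exact ⟨⟨hb _ (he 0 0), hb _ (he 1 0)⟩, ⟨hb _ (he 0 1), hb _ (he 1 1)⟩⟩

lemma shellMeasure_ne_zero : shellMeasure ≠ 0 := by
  intro h
  have h0 : shellMeasure Set.univ = 0 := by rw [h]; rfl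
  rw [shellMeasure, Measure.map_apply measurable_colNormalize MeasurableSet.univ,
    Set.preimage_univ, Measure.restrict_apply_univ] at h0
  have ho : IsOpen {p | ‖colDet p‖ ∈ Set.Ioo (1 : ℝ) 2} := by
    refine isOpen_Ioo.preimage (f := fun p => ‖colDet p‖) ?_
    unfold colDet
    fun_prop
  refine (ho.measure_pos volume ⟨((3 / 2, 0), (0, 1)), ?_⟩).ne'
    (measure_mono_null (Set.preimage_mono Set.Ioo_subset_Icc_self) h0)
  norm_num [colDet]

/-- For a left-invariant measure one compact set with non-empty interior and positive finite mass is
enough. The interior comes from `K`, the positive mass from a member of a compact exhaustion. -/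
instance : shellMeasure.IsHaarMeasure := by
  obtain ⟨n, hn⟩ : ∃ n, shellMeasure (compactCovering SL2C n) ≠ 0 := by
    by_contra! h
    refine shellMeasure_ne_zero (Measure.measure_univ_eq_zero.1 ?_)
    rw [← iUnion_compactCovering]
    exact measure_iUnion_null h
  obtain ⟨K⟩ : Nonempty (TopologicalSpace.PositiveCompacts SL2C) := inferInstance
  have hc : IsCompact ((K : Set SL2C) ∪ compactCovering SL2C n) :=
    K.isCompact.union (isCompact_compactCovering _ n)
  refine Measure.isHaarMeasure_of_isCompact_nonempty_interior shellMeasure _ hc ?_ ?_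
    hc.measure_lt_top.ne
  · exact K.interior_nonempty.mono (interior_mono Set.subset_union_left)
  · exact fun h => hn (measure_mono_null Set.subset_union_right h)

lemma normSqSL_colNormalize {p : (ℂ × ℂ) × (ℂ × ℂ)} (hp : colDet p ≠ 0) :
    normSqSL (colNormalize p) =
      (‖p.1.1‖ ^ 2 + ‖p.1.2‖ ^ 2 + (‖p.2.1‖ ^ 2 + ‖p.2.2‖ ^ 2)) / ‖colDet p‖ := by
  rw [normSqSL, colNormalize_val hp, div_eq_mul_inv, ← norm_colScale_sq hp]
  simp only [of_apply, cons_val', cons_val_zero, cons_val_one, cons_val_fin_one, norm_mul, mul_pow]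
  ring

/-! ### The radial part of the Haar measure -/

lemma mul_lintegral_Ioi_comp_mul {c : ℝ} (hc : 0 < c) (f : ℝ → ℝ≥0∞) :
    ENNReal.ofReal c * ∫⁻ x in Set.Ioi 0, f (c * x) = ∫⁻ x in Set.Ioi 0, f x := by
  have himg : (fun x => c * x) '' Set.Ioi 0 = Set.Ioi (0 : ℝ) := by
    rw [Set.image_mul_left_Ioi hc, mul_zero]
  conv_rhs => rw [← himg]
  rw [lintegral_image_eq_lintegral_abs_deriv_mul measurableSet_Ioi
    (fun x _ => ((hasDerivAt_id' x).const_mul c).hasDerivWithinAt)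
    (mul_right_injective₀ hc.ne').injOn, mul_one, abs_of_pos hc,
    lintegral_const_mul' _ _ ENNReal.ofReal_ne_top]

lemma lintegral_Ioi_comp_add (c : ℝ) (f : ℝ → ℝ≥0∞) :
    ∫⁻ x in Set.Ioi 0, f (c + x) = ∫⁻ x in Set.Ioi c, f x := by
  have himg : (fun x => c + x) '' Set.Ioi 0 = Set.Ioi c := by
    simp
  conv_rhs => rw [← himg]
  rw [lintegral_image_eq_lintegral_abs_deriv_mul measurableSet_Ioi
    (fun x _ => ((hasDerivAt_id' x).const_add c).hasDerivWithinAt)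
    (add_right_injective c).injOn]
  simp

/-- The law of `‖z‖²` under Lebesgue measure on `ℂ`. -/
lemma lintegral_complex_norm_sq {f : ℝ → ℝ≥0∞} (hf : Measurable f) :
    ∫⁻ z : ℂ, f (‖z‖ ^ 2) = ENNReal.ofReal Real.pi * ∫⁻ s in Set.Ioi 0, f s := by
  have himg : (fun x : ℝ => x ^ 2) '' Set.Ioi 0 = Set.Ioi 0 := by
    ext y
    constructor
    · rintro ⟨x, hx, rfl⟩
      exact pow_pos (Set.mem_Ioi.1 hx) 2
    · intro hy
      exact ⟨√y, Real.sqrt_pos.2 hy, Real.sq_sqrt (le_of_lt hy)⟩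
  have hsub : ∫⁻ s in Set.Ioi 0, f s =
      2 * ∫⁻ x in Set.Ioi 0, ENNReal.ofReal x * f (x ^ 2) := by
    conv_lhs => rw [← himg]
    rw [lintegral_image_eq_lintegral_abs_deriv_mul measurableSet_Ioi
      (fun x _ => (hasDerivAt_pow 2 x).hasDerivWithinAt)
      (fun x hx y hy h => (pow_left_inj₀ (le_of_lt hx) (le_of_lt hy) two_ne_zero).1 h),
      ← lintegral_const_mul' _ _ ENNReal.ofNat_ne_top]
    refine setLIntegral_congr_fun measurableSet_Ioi fun x hx => ?_
    have hx : 0 < x := hx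
    have h2 : |((2 : ℕ) : ℝ) * x ^ (2 - 1)| = 2 * x := by
      rw [abs_of_pos (by positivity)]
      norm_num
    simp only [h2]
    rw [ENNReal.ofReal_mul zero_le_two, ENNReal.ofReal_ofNat, mul_assoc]
  -- The angle contributes `2π`; its factor `2` is absorbed by `ds = 2x dx`.
  rw [← Complex.lintegral_comp_polarCoord_symm, hsub]
  simp only [Complex.norm_polarCoord_symm, sq_abs]
  rw [polarCoord_target, Measure.volume_eq_prod, ← Measure.prod_restrict, lintegral_prod]
  · simp only [lintegral_const, Measure.restrict_apply MeasurableSet.univ, Set.univ_inter,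
      Real.volume_Ioo]
    rw [lintegral_mul_const _ (by fun_prop), mul_comm, ← mul_assoc]
    congr 1
    rw [sub_neg_eq_add, ← two_mul, ENNReal.ofReal_mul zero_le_two, ENNReal.ofReal_ofNat, mul_comm]
  · have : Measurable fun p : ℝ × ℝ => ENNReal.ofReal p.1 * f (p.1 ^ 2) := by fun_prop
    exact this.aemeasurable

lemma lintegral_complex_prod_norm_sq {f : ℝ → ℝ → ℝ≥0∞} (hf : Measurable (Function.uncurry f)) :
    ∫⁻ w : ℂ × ℂ, f (‖w.1‖ ^ 2) (‖w.2‖ ^ 2) =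
      ENNReal.ofReal Real.pi ^ 2 * ∫⁻ a in Set.Ioi 0, ∫⁻ b in Set.Ioi 0, f a b := by
  have hm : Measurable fun w : ℂ × ℂ => f (‖w.1‖ ^ 2) (‖w.2‖ ^ 2) :=
    hf.comp (f := fun w : ℂ × ℂ => (‖w.1‖ ^ 2, ‖w.2‖ ^ 2)) (by fun_prop)
  rw [Measure.volume_eq_prod, lintegral_prod _ hm.aemeasurable]
  have h1 : ∀ z : ℂ, ∫⁻ w : ℂ, f (‖z‖ ^ 2) (‖w‖ ^ 2) =
      ENNReal.ofReal Real.pi * ∫⁻ b in Set.Ioi 0, f (‖z‖ ^ 2) b := fun z =>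
    lintegral_complex_norm_sq hf.of_uncurry_left
  simp only [h1]
  rw [lintegral_const_mul' _ _ ENNReal.ofReal_ne_top,
    lintegral_complex_norm_sq (f := fun a => ∫⁻ b in Set.Ioi 0, f a b) hf.lintegral_prod_right',
    sq, mul_assoc]

/-- The law of the squared norm under Lebesgue measure on `ℂ²`. -/
lemma lintegral_complex_prod_norm_sq_add {f : ℝ → ℝ≥0∞} (hf : Measurable f) :
    ∫⁻ v : ℂ × ℂ, f (‖v.1‖ ^ 2 + ‖v.2‖ ^ 2) =
      ENNReal.ofReal Real.pi ^ 2 * ∫⁻ s in Set.Ioi 0, ENNReal.ofReal s * f s := by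
  rw [lintegral_complex_prod_norm_sq (f := fun a b => f (a + b)) (by fun_prop)]
  congr 1
  -- With `s = a + b` the domain is `0 < a < s`; integrating out `a` leaves the weight `s`.
  have h1 : ∀ a ∈ Set.Ioi (0 : ℝ), ∫⁻ b in Set.Ioi 0, f (a + b) =
      ∫⁻ s in Set.Ioi 0, {p : ℝ × ℝ | p.1 < p.2}.indicator (fun p => f p.2) (a, s) := by
    intro a ha
    rw [lintegral_Ioi_comp_add, ← lintegral_indicator measurableSet_Ioi,
      ← lintegral_indicator measurableSet_Ioi]
    refine lintegral_congr fun s => ?_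
    have ha : 0 < a := ha
    by_cases h : a < s
    · simp [Set.indicator, h, ha.trans h]
    · simp [Set.indicator, h]
  rw [setLIntegral_congr_fun measurableSet_Ioi h1, lintegral_lintegral_swap]
  · refine setLIntegral_congr_fun measurableSet_Ioi fun s hs => ?_
    have : (fun a => {p : ℝ × ℝ | p.1 < p.2}.indicator (fun p => f p.2) (a, s)) =
        (Set.Iio s).indicator fun _ => f s := rfl
    simp only [this]
    rw [lintegral_indicator measurableSet_Iio, lintegral_const,
      Measure.restrict_apply MeasurableSet.univ, Set.univ_inter,
      Measure.restrict_apply measurableSet_Iio, Set.inter_comm, Set.Ioi_inter_Iio,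
      Real.volume_Ioo, sub_zero, mul_comm]
  · exact ((by fun_prop : Measurable fun p : ℝ × ℝ => f p.2).indicator
      (measurableSet_lt measurable_fst measurable_snd)).aemeasurable

/-- Rotating the first column of a matrix to a multiple of the first basis vector. -/
lemma exists_rotate_column (v : ℂ × ℂ) (hv : v ≠ 0) : ∃ g : SL2C, ∀ w : ℂ × ℂ,
    ‖colDet (v, w)‖ ^ 2 = (‖v.1‖ ^ 2 + ‖v.2‖ ^ 2) * ‖(actVec g w).2‖ ^ 2 ∧
    ‖w.1‖ ^ 2 + ‖w.2‖ ^ 2 = ‖(actVec g w).1‖ ^ 2 + ‖(actVec g w).2‖ ^ 2 := by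
  set N : ℝ := ‖v.1‖ ^ 2 + ‖v.2‖ ^ 2 with hN
  have hpos : 0 < N := by
    rcases eq_or_ne v.1 0 with h | h
    · have h2 : v.2 ≠ 0 := fun h2 => hv (Prod.ext h h2)
      have := norm_pos_iff.2 h2
      positivity
    · have := norm_pos_iff.2 h
      positivity
  have hs : (((√N)⁻¹ : ℝ) : ℂ) * (((√N)⁻¹ : ℝ) : ℂ) * (N : ℂ) = 1 := by
    norm_cast
    rw [← mul_inv, Real.mul_self_sqrt hpos.le, inv_mul_cancel₀ hpos.ne']
  have hNc : (N : ℂ) = star v.1 * v.1 + star v.2 * v.2 := by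
    simp only [RCLike.star_def, ← Complex.normSq_eq_conj_mul_self, hN, Complex.normSq_eq_norm_sq]
    push_cast
    ring
  have hsq : ((√N)⁻¹) ^ 2 = N⁻¹ := by rw [inv_pow, Real.sq_sqrt hpos.le]
  -- This unitary matrix sends `v` to `(√N, 0)`, so the determinant of `(v, w)` is `√N` times the
  -- second entry of the image of `w`.
  refine ⟨⟨!![(((√N)⁻¹ : ℝ) : ℂ) * star v.1, (((√N)⁻¹ : ℝ) : ℂ) * star v.2;
    (((√N)⁻¹ : ℝ) : ℂ) * -v.2, (((√N)⁻¹ : ℝ) : ℂ) * v.1], ?_⟩, fun w => ?_⟩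
  · rw [det_fin_two_of, ← hs, hNc]
    ring
  · have h1 : ∀ z z' : ℂ, (((√N)⁻¹ : ℝ) : ℂ) * z * w.1 + (((√N)⁻¹ : ℝ) : ℂ) * z' * w.2 =
        (((√N)⁻¹ : ℝ) : ℂ) * (z * w.1 + z' * w.2) := fun z z' => by ring
    have h2 : ∀ z : ℂ, ‖(((√N)⁻¹ : ℝ) : ℂ) * z‖ ^ 2 = N⁻¹ * ‖z‖ ^ 2 := fun z => by
      rw [norm_mul, mul_pow, Complex.norm_real, Real.norm_eq_abs, sq_abs, hsq]
    simp only [actVec, of_apply, cons_val', cons_val_zero, cons_val_one, cons_val_fin_one, h1, h2]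
    rw [← mul_add, ← mul_assoc, mul_inv_cancel₀ hpos.ne', one_mul]
    refine ⟨?_, ?_⟩
    · rw [colDet]
      congr 2
      ring
    · rw [eq_inv_mul_iff_mul_eq₀ hpos.ne', hN]
      simp only [Complex.sq_norm, Complex.normSq_apply, RCLike.star_def, Complex.add_re,
        Complex.add_im, Complex.mul_re, Complex.mul_im, Complex.conj_re, Complex.conj_im,
        Complex.neg_re, Complex.neg_im]
      ring

/-- The joint law of the absolute value of the determinant and of the Frobenius norm under
Lebesgue measure on `M₂(ℂ)`. -/
lemma lintegral_colDet_norm {F : ℝ → ℝ → ℝ≥0∞} (hF : Measurable (Function.uncurry F)) :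
    ∫⁻ p : (ℂ × ℂ) × (ℂ × ℂ), F (‖colDet p‖ ^ 2)
        (‖p.1.1‖ ^ 2 + ‖p.1.2‖ ^ 2 + (‖p.2.1‖ ^ 2 + ‖p.2.2‖ ^ 2)) =
      ENNReal.ofReal Real.pi ^ 4 * ∫⁻ s in Set.Ioi 0, ENNReal.ofReal s *
        ∫⁻ a in Set.Ioi 0, ∫⁻ b in Set.Ioi 0, F (s * b) (s + (a + b)) := by
  have hm : Measurable fun p : (ℂ × ℂ) × (ℂ × ℂ) => F (‖colDet p‖ ^ 2)
      (‖p.1.1‖ ^ 2 + ‖p.1.2‖ ^ 2 + (‖p.2.1‖ ^ 2 + ‖p.2.2‖ ^ 2)) :=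
    hF.comp ((measurable_colDet.norm.pow_const 2).prodMk (by fun_prop))
  have hv : ∀ v : ℂ × ℂ, ∫⁻ w : ℂ × ℂ, F (‖colDet (v, w)‖ ^ 2)
      (‖v.1‖ ^ 2 + ‖v.2‖ ^ 2 + (‖w.1‖ ^ 2 + ‖w.2‖ ^ 2)) =
      ∫⁻ w : ℂ × ℂ, F ((‖v.1‖ ^ 2 + ‖v.2‖ ^ 2) * ‖w.2‖ ^ 2)
        (‖v.1‖ ^ 2 + ‖v.2‖ ^ 2 + (‖w.1‖ ^ 2 + ‖w.2‖ ^ 2)) := by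
    intro v
    rcases eq_or_ne v 0 with rfl | hv
    · simp [colDet]
    · obtain ⟨g, hg⟩ := exists_rotate_column v hv
      have hm2 : Measurable fun w : ℂ × ℂ => F ((‖v.1‖ ^ 2 + ‖v.2‖ ^ 2) * ‖w.2‖ ^ 2)
          (‖v.1‖ ^ 2 + ‖v.2‖ ^ 2 + (‖w.1‖ ^ 2 + ‖w.2‖ ^ 2)) :=
        hF.comp (Measurable.prodMk (by fun_prop) (by fun_prop))
      rw [← (measurePreserving_actVec g).lintegral_comp hm2]
      exact lintegral_congr fun w => by rw [(hg w).1, (hg w).2]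
  have hin : Measurable fun s : ℝ =>
      ∫⁻ a in Set.Ioi 0, ∫⁻ b in Set.Ioi 0, F (s * b) (s + (a + b)) := by
    refine Measurable.lintegral_prod_right' (f := fun q : ℝ × ℝ =>
      ∫⁻ b in Set.Ioi 0, F (q.1 * b) (q.1 + (q.2 + b))) ?_
    refine Measurable.lintegral_prod_right' (f := fun q : (ℝ × ℝ) × ℝ =>
      F (q.1.1 * q.2) (q.1.1 + (q.1.2 + q.2))) ?_
    exact hF.comp (Measurable.prodMk (by fun_prop) (by fun_prop))
  rw [Measure.volume_eq_prod, lintegral_prod _ hm.aemeasurable]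
  simp only [hv]
  have hw : ∀ s : ℝ, ∫⁻ w : ℂ × ℂ, F (s * ‖w.2‖ ^ 2) (s + (‖w.1‖ ^ 2 + ‖w.2‖ ^ 2)) =
      ENNReal.ofReal Real.pi ^ 2 *
        ∫⁻ a in Set.Ioi 0, ∫⁻ b in Set.Ioi 0, F (s * b) (s + (a + b)) := fun s =>
    lintegral_complex_prod_norm_sq (f := fun a b => F (s * b) (s + (a + b)))
      (hF.comp (f := fun q : ℝ × ℝ => (s * q.2, s + (q.1 + q.2))) (by fun_prop))
  simp only [hw]
  rw [lintegral_const_mul' _ _ (by simp), lintegral_complex_prod_norm_sq_add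
    (f := fun s => ∫⁻ a in Set.Ioi 0, ∫⁻ b in Set.Ioi 0, F (s * b) (s + (a + b))) hin,
    ← mul_assoc, ← pow_add]

/-- The substitution `q = s b` uses up the weight `s`. Then `s = √q u` and the rescaling of `a` each
produce a factor `√q`, after which the normalised norm `u + u⁻¹ + a` no longer involves `q`. -/
lemma lintegral_det_frobenius_substitution {F : ℝ → ℝ → ℝ≥0∞}
    (hF : Measurable (Function.uncurry F)) :
    ∫⁻ s in Set.Ioi 0, ENNReal.ofReal s *
        ∫⁻ a in Set.Ioi 0, ∫⁻ b in Set.Ioi 0, F (s * b) (s + (a + b)) =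
      ∫⁻ q in Set.Ioi 0, ENNReal.ofReal (√q) * (ENNReal.ofReal (√q) *
        ∫⁻ u in Set.Ioi 0, ∫⁻ a in Set.Ioi 0, F q (√q * (u + u⁻¹ + a))) := by
  have h1 : ∀ s ∈ Set.Ioi (0 : ℝ), ENNReal.ofReal s *
      ∫⁻ a in Set.Ioi 0, ∫⁻ b in Set.Ioi 0, F (s * b) (s + (a + b)) =
      ∫⁻ q in Set.Ioi 0, ∫⁻ a in Set.Ioi 0, F q (s + (a + q / s)) := by
    intro s hs
    have hs : 0 < s := hs
    rw [lintegral_lintegral_swap]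
    · refine Eq.trans ?_ (mul_lintegral_Ioi_comp_mul hs _)
      simp only [mul_div_cancel_left₀ _ hs.ne']
    · exact (hF.comp (f := fun p : ℝ × ℝ => (s * p.2, s + (p.1 + p.2)))
        (by fun_prop)).aemeasurable
  rw [setLIntegral_congr_fun measurableSet_Ioi h1, lintegral_lintegral_swap]
  · refine setLIntegral_congr_fun measurableSet_Ioi fun q hq => ?_
    have hq : 0 < √q := Real.sqrt_pos.2 hq
    have hqq : √q * √q = q := Real.mul_self_sqrt (Real.sqrt_pos.1 hq).le
    rw [← mul_lintegral_Ioi_comp_mul hq]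
    congr 1
    rw [← lintegral_const_mul' _ _ ENNReal.ofReal_ne_top]
    refine setLIntegral_congr_fun measurableSet_Ioi fun u hu => ?_
    have hu : 0 < u := hu
    rw [← mul_lintegral_Ioi_comp_mul hq]
    congr 1
    refine lintegral_congr fun a => ?_
    congr 1
    have : q / (√q * u) = √q * u⁻¹ := by
      nth_rw 1 [← hqq]
      field_simp
    rw [this]
    ring
  · have : Measurable fun z : (ℝ × ℝ) × ℝ => F z.1.2 (z.1.1 + (z.2 + z.1.2 / z.1.1)) :=
      hF.comp (Measurable.prodMk (by fun_prop) (by fun_prop))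
    exact this.lintegral_prod_right'.aemeasurable

/-- Multiplied by `u`, the inequality is quadratic with roots `e^{±r}`. The length of this interval
is one of the two factors `2 sinh r`. -/
lemma setOf_add_inv_lt_two_mul_cosh {r : ℝ} (hr : 0 < r) :
    {u : ℝ | u + u⁻¹ < 2 * Real.cosh r} ∩ Set.Ioi 0 = Set.Ioo (Real.exp (-r)) (Real.exp r) := by
  have he : Real.exp (-r) * Real.exp r = 1 := by rw [← Real.exp_add]; simp
  have hlt : Real.exp (-r) < Real.exp r := Real.exp_lt_exp.2 (by linarith)
  have hp := Real.exp_pos (-r)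
  ext u
  rw [Set.mem_inter_iff, Set.mem_ofPred_eq, Set.mem_Ioi, Set.mem_Ioo, Real.cosh_eq]
  have key : 0 < u → (u + u⁻¹ < 2 * ((Real.exp r + Real.exp (-r)) / 2) ↔
      (u - Real.exp (-r)) * (u - Real.exp r) < 0) := by
    intro hu
    rw [← mul_lt_mul_iff_right₀ hu, mul_add, mul_inv_cancel₀ hu.ne']
    constructor <;> intro h <;> nlinarith
  constructor
  · rintro ⟨h, hu⟩
    rw [key hu] at h
    constructor <;> nlinarith
  · rintro ⟨h1, h2⟩
    have hu : 0 < u := hp.trans h1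
    exact ⟨(key hu).2 (mul_neg_of_pos_of_neg (by linarith) (by linarith)), hu⟩

lemma lintegral_Ioi_two_eq_cosh (f : ℝ → ℝ≥0∞) :
    ∫⁻ t in Set.Ioi 2, f t =
      ∫⁻ r in Set.Ioi 0, ENNReal.ofReal (2 * Real.sinh r) * f (2 * Real.cosh r) := by
  have himg : (fun r => 2 * Real.cosh r) '' Set.Ioi 0 = Set.Ioi 2 := by
    ext t
    constructor
    · rintro ⟨r, hr, rfl⟩
      have := Real.one_lt_cosh.2 (ne_of_gt hr)
      rw [Set.mem_Ioi]
      linarith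
    · intro ht
      have ht : 1 < t / 2 := by rw [Set.mem_Ioi] at ht; linarith
      exact ⟨Real.arcosh (t / 2), Real.arcosh_pos ht, by
        simp only [Real.cosh_arcosh ht.le]; ring⟩
  rw [← himg, lintegral_image_eq_lintegral_abs_deriv_mul measurableSet_Ioi
    (fun x _ => ((Real.hasDerivAt_cosh x).const_mul 2).hasDerivWithinAt)]
  · refine setLIntegral_congr_fun measurableSet_Ioi fun r hr => ?_
    rw [abs_of_pos (mul_pos two_pos (Real.sinh_pos_iff.2 hr))]
  · intro x hx y hy h
    have h : 2 * Real.cosh x = 2 * Real.cosh y := h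
    exact Real.cosh_strictMonoOn.injOn (Set.Ioi_subset_Ici_self hx) (Set.Ioi_subset_Ici_self hy)
      (by linarith)

/-- Origin of `sinh²`: with `t = u + u⁻¹ + a` in place of `a`, integrating out `u` gives `2 sinh r`,
and `t = 2 cosh r` gives the same factor again. -/
lemma lintegral_add_inv_add {h : ℝ → ℝ≥0∞} (hh : Measurable h) :
    ∫⁻ u in Set.Ioi 0, ∫⁻ a in Set.Ioi 0, h (u + u⁻¹ + a) =
      4 * ∫⁻ r in Set.Ioi 0, ENNReal.ofReal (Real.sinh r ^ 2) * h (2 * Real.cosh r) := by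
  have hge : ∀ u : ℝ, 0 < u → 2 ≤ u + u⁻¹ := fun u hu => by
    have : u * u⁻¹ = 1 := mul_inv_cancel₀ hu.ne'
    nlinarith [sq_nonneg (u - u⁻¹), inv_pos.2 hu]
  have h1 : ∀ u ∈ Set.Ioi (0 : ℝ), ∫⁻ a in Set.Ioi 0, h (u + u⁻¹ + a) =
      ∫⁻ t in Set.Ioi 2, {p : ℝ × ℝ | p.1 + p.1⁻¹ < p.2}.indicator (fun p => h p.2) (u, t) := by
    intro u hu
    rw [lintegral_Ioi_comp_add, ← lintegral_indicator measurableSet_Ioi,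
      ← lintegral_indicator measurableSet_Ioi]
    refine lintegral_congr fun t => ?_
    by_cases ht : u + u⁻¹ < t
    · simp [Set.indicator, ht, (hge u hu).trans_lt ht]
    · simp [Set.indicator, ht]
  have hms : MeasurableSet {p : ℝ × ℝ | p.1 + p.1⁻¹ < p.2} :=
    measurableSet_lt (by fun_prop) (by fun_prop)
  rw [setLIntegral_congr_fun measurableSet_Ioi h1, lintegral_lintegral_swap]
  · rw [lintegral_Ioi_two_eq_cosh, ← lintegral_const_mul' _ _ ENNReal.ofNat_ne_top]
    refine setLIntegral_congr_fun measurableSet_Ioi fun r hr => ?_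
    have hind : ∀ t : ℝ, (fun u => {p : ℝ × ℝ | p.1 + p.1⁻¹ < p.2}.indicator (fun p => h p.2)
        (u, t)) = {u : ℝ | u + u⁻¹ < t}.indicator fun _ => h t := fun _ => rfl
    simp only [hind]
    rw [lintegral_indicator (measurableSet_lt (by fun_prop) (by fun_prop)), lintegral_const,
      Measure.restrict_apply MeasurableSet.univ, Set.univ_inter,
      Measure.restrict_apply (measurableSet_lt (by fun_prop) (by fun_prop)),
      setOf_add_inv_lt_two_mul_cosh hr, Real.volume_Ioo]
    have h2 : Real.exp r - Real.exp (-r) = 2 * Real.sinh r := by rw [Real.sinh_eq]; ring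
    have hs : 0 ≤ 2 * Real.sinh r := mul_nonneg zero_le_two (Real.sinh_pos_iff.2 hr).le
    rw [h2, mul_comm (h _), ← mul_assoc, ← mul_assoc, ← ENNReal.ofReal_mul hs,
      ← ENNReal.ofReal_ofNat 4, ← ENNReal.ofReal_mul (by norm_num)]
    congr 2
    ring
  · exact ((by fun_prop : Measurable fun p : ℝ × ℝ => h p.2).indicator hms).aemeasurable

/-- The law of the squared Frobenius norm under the Haar measure `shellMeasure`. -/
theorem exists_lintegral_normSqSL_shellMeasure : ∃ C : ℝ≥0∞, C ≠ ∞ ∧ ∀ h : ℝ → ℝ≥0∞, Measurable h →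
    ∫⁻ g, h (normSqSL g) ∂shellMeasure =
      C * ∫⁻ r in Set.Ioi 0, ENNReal.ofReal (Real.sinh r ^ 2) * h (2 * Real.cosh r) := by
  set S : Set ℝ := {q | √q ∈ Set.Icc (1 : ℝ) 2} with hS
  have hSm : MeasurableSet S := Real.continuous_sqrt.measurable measurableSet_Icc
  -- The contribution of `q = |det|²`, which splits off as a constant; only its finiteness is
  -- needed.
  set I : ℝ≥0∞ := ∫⁻ q in Set.Ioi 0, S.indicator (fun q => ENNReal.ofReal (√q) *
    ENNReal.ofReal (√q)) q with hI
  have hIfin : I ≠ ∞ := by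
    have hle : I ≤ ∫⁻ q in Set.Ioi 0, (Set.Ioc (0 : ℝ) 4).indicator (fun _ => 4) q := by
      refine lintegral_mono_ae ?_
      filter_upwards [ae_restrict_mem measurableSet_Ioi] with q hq
      by_cases hqS : q ∈ S
      · have hq4 : q ≤ 4 := by
          rw [← Real.sq_sqrt (le_of_lt (Set.mem_Ioi.1 hq))]
          nlinarith [hqS.1, hqS.2]
        rw [Set.indicator_of_mem hqS, Set.indicator_of_mem (Set.mem_Ioc.2 ⟨hq, hq4⟩),
          ← ENNReal.ofReal_mul (Real.sqrt_nonneg q), Real.mul_self_sqrt (le_of_lt hq)]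
        exact ENNReal.ofReal_le_of_le_toReal (by simpa using hq4)
      · rw [Set.indicator_of_notMem hqS]
        exact zero_le
    refine (hle.trans_lt ?_).ne
    rw [lintegral_indicator measurableSet_Ioc, lintegral_const, Measure.restrict_apply
      MeasurableSet.univ, Set.univ_inter, Measure.restrict_apply measurableSet_Ioc]
    refine ENNReal.mul_lt_top (by simp) ((measure_mono Set.inter_subset_left).trans_lt ?_)
    simp
  refine ⟨ENNReal.ofReal Real.pi ^ 4 * (I * 4), ?_, fun h hh => ?_⟩
  · exact ENNReal.mul_ne_top (by simp) (ENNReal.mul_ne_top hIfin (by simp))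
  have hn : Measurable fun g => h (normSqSL g) := hh.comp measurable_normSqSL
  let F : ℝ → ℝ → ℝ≥0∞ := fun q N => S.indicator (fun q => h (N / √q)) q
  have hF : Measurable (Function.uncurry F) := by
    have h1 : Measurable fun p : ℝ × ℝ => h (p.2 / √p.1) := by fun_prop
    exact h1.indicator (measurable_fst hSm)
  have hstart : ∫⁻ g, h (normSqSL g) ∂shellMeasure =
      ∫⁻ p : (ℂ × ℂ) × (ℂ × ℂ), F (‖colDet p‖ ^ 2)
        (‖p.1.1‖ ^ 2 + ‖p.1.2‖ ^ 2 + (‖p.2.1‖ ^ 2 + ‖p.2.2‖ ^ 2)) := by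
    rw [lintegral_shellMeasure hn, ← lintegral_indicator measurableSet_detShell]
    refine lintegral_congr fun p => ?_
    have hiff : ‖colDet p‖ ^ 2 ∈ S ↔ p ∈ detShell := by
      simp only [hS, detShell, Set.mem_ofPred_eq, Real.sqrt_sq (norm_nonneg _)]
    by_cases hp : p ∈ detShell
    · simp only [F]
      rw [Set.indicator_of_mem hp, Set.indicator_of_mem (hiff.2 hp),
        normSqSL_colNormalize (colDet_ne_zero_of_mem_detShell hp), Real.sqrt_sq (norm_nonneg _)]
    · simp only [F]
      rw [Set.indicator_of_notMem hp, Set.indicator_of_notMem fun h => hp (hiff.1 h)]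
  rw [hstart, lintegral_colDet_norm hF, lintegral_det_frobenius_substitution hF, mul_assoc,
    mul_assoc I, ← lintegral_add_inv_add hh, hI]
  congr 1
  have hm : Measurable (S.indicator fun q => ENNReal.ofReal (√q) * ENNReal.ofReal (√q)) :=
    Measurable.indicator (by fun_prop) hSm
  rw [← lintegral_mul_const _ hm]
  refine setLIntegral_congr_fun measurableSet_Ioi fun q hq => ?_
  have hq0 : √q ≠ 0 := (Real.sqrt_pos.2 hq).ne'
  by_cases hqS : q ∈ S
  · simp only [F, Set.indicator_of_mem hqS, mul_div_cancel_left₀ _ hq0]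
    rw [mul_assoc]
  · simp only [F, Set.indicator_of_notMem hqS]
    simp

/-! ### The Haar measure in Cartan coordinates -/

/-- A Haar measure on a compact second countable group is right invariant. -/
lemma isMulRightInvariant_of_compactSpace {G : Type*} [Group G] [TopologicalSpace G]
    [IsTopologicalGroup G] [MeasurableSpace G] [BorelSpace G] [CompactSpace G]
    (μ : Measure G) [μ.IsHaarMeasure] : μ.IsMulRightInvariant where
  map_mul_right_eq_self g := by
    -- A right translate is left invariant, hence a multiple of `μ`; comparing the finite total
    -- masses shows the multiple to be `1`.
    have h := Measure.isMulInvariant_eq_smul_of_compactSpace (μ.map (· * g)) μ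
    have hu := congrArg (fun ν : Measure G => ν Set.univ) h
    simp only [Measure.map_apply (measurable_mul_const g) MeasurableSet.univ, Set.preimage_univ,
      Measure.smul_apply] at hu
    have h0 : μ Set.univ ≠ 0 := Measure.measure_univ_ne_zero.2 (NeZero.ne μ)
    have hc : ((Measure.haarScalarFactor (μ.map (· * g)) μ : NNReal) : ℝ≥0∞) = 1 := by
      rw [ENNReal.smul_def, smul_eq_mul] at hu
      exact (ENNReal.mul_eq_right h0 (measure_ne_top μ _)).1 hu.symm
    rw [h, ENNReal.coe_eq_one.1 hc, one_smul]

instance (a : ℝ) : SigmaFinite (lebesgueIci a) := by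
  have he := MeasurableEmbedding.subtype_coe (measurableSet_Ici (a := a))
  refine SigmaFinite.of_map (f := Subtype.val) _ he.measurable.aemeasurable ?_
  rw [lebesgueIci, he.map_comap]
  infer_instance

lemma lintegral_lebesgueIci (a : ℝ) (f : ℝ → ℝ≥0∞) :
    ∫⁻ x, f x ∂lebesgueIci a = ∫⁻ x in Set.Ici a, f x :=
  lintegral_subtype_comap measurableSet_Ici f

lemma measurable_lintegral_kak (μ μ' : Measure SU2) [IsFiniteMeasure μ] [IsFiniteMeasure μ']
    {f : SL2C → ℝ≥0∞} (hf : Measurable f) :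
    Measurable fun g => ∫⁻ k, ∫⁻ k', f (toSL k * g * toSL k') ∂μ' ∂μ := by
  have h := continuous_toSL
  have h1 : Measurable fun q : (SL2C × SU2) × SU2 => f (toSL q.1.2 * q.1.1 * toSL q.2) :=
    hf.comp (Continuous.measurable (by fun_prop))
  exact (h1.lintegral_prod_right').lintegral_prod_right' (ν := μ)

/-- A `K`-bi-invariant average is a function of the Frobenius norm. -/
lemma lintegral_kak_eq (μ μ' : Measure SU2) [μ.IsHaarMeasure] [μ'.IsHaarMeasure]
    (f : SL2C → ℝ≥0∞) (g : SL2C) :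
    ∫⁻ k, ∫⁻ k', f (toSL k * g * toSL k') ∂μ' ∂μ =
      ∫⁻ k, ∫⁻ k', f (toSL k * cartanA (Real.arcosh (normSqSL g / 2)) * toSL k') ∂μ' ∂μ := by
  have := isMulRightInvariant_of_compactSpace μ
  obtain ⟨⟨k₀, ⟨r, hr⟩, k₁⟩, rfl⟩ := kak_surjective g
  have hn : normSqSL (kak (k₀, ⟨r, hr⟩, k₁)) = 2 * Real.cosh r := by
    rw [kak, normSqSL_mul_toSL, normSqSL_toSL_mul, normSqSL_cartanA]
  rw [hn, mul_div_cancel_left₀ _ two_ne_zero, Real.arcosh_cosh hr]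
  have h1 : ∀ k k', f (toSL k * kak (k₀, ⟨r, hr⟩, k₁) * toSL k') =
      f (toSL (k * k₀) * cartanA r * toSL (k₁ * k')) := fun k k' => by
    simp only [kak, toSL_mul, mul_assoc]
  simp only [h1]
  -- Right invariance of `μ` absorbs `k₀`, and left invariance of `μ'` absorbs `k₁`.
  rw [lintegral_mul_right_eq_self
    (fun k => ∫⁻ k', f (toSL k * cartanA r * toSL (k₁ * k')) ∂μ') k₀]
  refine lintegral_congr fun k => ?_
  exact lintegral_mul_left_eq_self (fun k' => f (toSL k * cartanA r * toSL k')) k₁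

lemma lintegral_cartanMeasure (μ μ' : Measure SU2) [IsFiniteMeasure μ] [IsFiniteMeasure μ']
    {f : SL2C → ℝ≥0∞} (hf : Measurable f) :
    ∫⁻ p, f (kak p) ∂cartanMeasure μ μ' = ∫⁻ r in Set.Ioi 0, ENNReal.ofReal (Real.sinh r ^ 2) *
      ∫⁻ k, ∫⁻ k', f (toSL k * cartanA r * toSL k') ∂μ' ∂μ := by
  have hk := hf.comp continuous_kak.measurable
  have hA := continuous_cartanA
  have hT := continuous_toSL
  have hd : Measurable fun p : SU2 × Set.Ici (0 : ℝ) × SU2 =>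
      ENNReal.ofReal (Real.sinh (p.2.1 : ℝ) ^ 2) :=
    (Real.measurable_sinh.comp (by fun_prop)).pow_const 2 |>.ennreal_ofReal
  have hm := hd.mul hk
  have hm3 : Measurable fun q : (SU2 × Set.Ici (0 : ℝ)) × SU2 =>
      f (toSL q.1.1 * cartanA q.1.2 * toSL q.2) :=
    hf.comp (Continuous.measurable (by fun_prop))
  refine (lintegral_withDensity_eq_lintegral_mul _ hd hk).trans ?_
  rw [lintegral_prod _ hm.aemeasurable]
  have h1 : ∀ k : SU2, ∫⁻ q : Set.Ici (0 : ℝ) × SU2,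
      ((fun p : SU2 × Set.Ici (0 : ℝ) × SU2 => ENNReal.ofReal (Real.sinh (p.2.1 : ℝ) ^ 2)) *
        (f ∘ kak)) (k, q) ∂((lebesgueIci 0).prod μ') =
      ∫⁻ r : Set.Ici (0 : ℝ), ENNReal.ofReal (Real.sinh r ^ 2) *
        ∫⁻ k', f (toSL k * cartanA r * toSL k') ∂μ' ∂lebesgueIci 0 := fun k => by
    refine (lintegral_prod _ (hm.comp measurable_prodMk_left).aemeasurable).trans ?_
    refine lintegral_congr fun r => ?_
    exact lintegral_const_mul' (ENNReal.ofReal (Real.sinh r ^ 2))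
      (fun k' => f (toSL k * cartanA r * toSL k')) ENNReal.ofReal_ne_top
  simp only [Function.comp_def] at h1 ⊢
  simp only [h1]
  rw [lintegral_lintegral_swap]
  · simp only [lintegral_const_mul' _ _ ENNReal.ofReal_ne_top]
    rw [lintegral_lebesgueIci 0 fun r => ENNReal.ofReal (Real.sinh r ^ 2) *
      ∫⁻ k, ∫⁻ k', f (toSL k * cartanA r * toSL k') ∂μ' ∂μ]
    exact setLIntegral_congr Ioi_ae_eq_Ici.symm
  · refine Measurable.aemeasurable ?_
    refine Measurable.mul ?_ hm3.lintegral_prod_right'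
    exact ((Real.measurable_sinh.comp (by fun_prop)).pow_const 2).ennreal_ofReal

/-- Averaging a test function over `K × K` multiplies its `shellMeasure`-integral by the mass `m`.
The average is a function of the Frobenius norm, so the law of the norm turns the integral into the
Cartan integral. -/
theorem exists_map_kak_eq_smul_shellMeasure (μ μ' : Measure SU2) [μ.IsHaarMeasure]
    [μ'.IsHaarMeasure] : ∃ c : ℝ≥0∞, c ≠ 0 ∧ c ≠ ∞ ∧
      (cartanMeasure μ μ').map kak = c • shellMeasure := by
  obtain ⟨C, hC, hCh⟩ := exists_lintegral_normSqSL_shellMeasure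
  have hT := continuous_toSL
  set m := μ Set.univ * μ' Set.univ with hm
  have hm0 : m ≠ 0 := mul_ne_zero (Measure.measure_univ_ne_zero.2 (NeZero.ne μ))
    (Measure.measure_univ_ne_zero.2 (NeZero.ne μ'))
  have hm1 : m ≠ ∞ := ENNReal.mul_ne_top (measure_ne_top _ _) (measure_ne_top _ _)
  have key : m • shellMeasure = C • (cartanMeasure μ μ').map kak := by
    refine Measure.ext_of_lintegral _ fun f hf => ?_
    rw [lintegral_smul_measure, lintegral_smul_measure, lintegral_map hf continuous_kak.measurable,
      lintegral_cartanMeasure μ μ' hf, smul_eq_mul, smul_eq_mul]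
    have hF := measurable_lintegral_kak μ μ' hf
    have hh : Measurable fun t : ℝ =>
        ∫⁻ k, ∫⁻ k', f (toSL k * cartanA (Real.arcosh (t / 2)) * toSL k') ∂μ' ∂μ := by
      refine hF.comp (continuous_cartanA.measurable.comp ?_)
      unfold Real.arcosh
      fun_prop
    calc m * ∫⁻ g, f g ∂shellMeasure
        = ∫⁻ g, ∫⁻ k, ∫⁻ k', f (toSL k * g * toSL k') ∂μ' ∂μ ∂shellMeasure := by
          have hm3 : Measurable fun q : (SL2C × SU2) × SU2 => f (toSL q.1.2 * q.1.1 * toSL q.2) :=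
            hf.comp (Continuous.measurable (by fun_prop))
          rw [lintegral_lintegral_swap hm3.lintegral_prod_right'.aemeasurable]
          have h1 : ∀ k, ∫⁻ g, ∫⁻ k', f (toSL k * g * toSL k') ∂μ' ∂shellMeasure =
              (∫⁻ g, f g ∂shellMeasure) * μ' Set.univ := by
            intro k
            have hm2 : Measurable fun q : SL2C × SU2 => f (toSL k * q.1 * toSL q.2) :=
              hf.comp (Continuous.measurable (by fun_prop))
            rw [lintegral_lintegral_swap hm2.aemeasurable, ← lintegral_const]
            refine lintegral_congr fun k' => ?_
            rw [lintegral_mul_left_eq_self (fun g => f (g * toSL k')) (toSL k),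
              lintegral_mul_right_eq_self f (toSL k')]
          simp only [h1]
          rw [lintegral_const, hm]
          ring
      _ = ∫⁻ g, (fun t : ℝ => ∫⁻ k, ∫⁻ k',
            f (toSL k * cartanA (Real.arcosh (t / 2)) * toSL k') ∂μ' ∂μ) (normSqSL g)
            ∂shellMeasure := lintegral_congr fun g => lintegral_kak_eq μ μ' f g
      _ = _ := by
          rw [hCh _ hh]
          congr 1
          refine setLIntegral_congr_fun measurableSet_Ioi fun r hr => ?_
          simp only [mul_div_cancel_left₀ (Real.cosh r) (two_ne_zero' ℝ),
            Real.arcosh_cosh (le_of_lt (Set.mem_Ioi.1 hr))]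
  -- Otherwise `shellMeasure` would vanish, so `C` need not be evaluated.
  have hC0 : C ≠ 0 := by
    rintro rfl
    rw [zero_smul] at key
    refine shellMeasure_ne_zero ?_
    rw [← one_smul ℝ≥0∞ shellMeasure, ← ENNReal.inv_mul_cancel hm0 hm1, mul_smul, key, smul_zero]
  refine ⟨C⁻¹ * m, mul_ne_zero (ENNReal.inv_ne_zero.2 hC) hm0,
    ENNReal.mul_ne_top (ENNReal.inv_ne_top.2 hC0) hm1, ?_⟩
  rw [mul_smul, key, smul_smul, ENNReal.inv_mul_cancel hC0 hC, one_smul]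

/-! ### The substitution `x = e^{r/2}` -/

lemma measurable_densityX : Measurable fun x : ℝ => 2 * ((x ^ 2 - (x ^ 2)⁻¹) / 2) ^ 2 * x⁻¹ := by
  fun_prop

/-- For `x = e^{r/2}` one has `sinh r = (x² - x⁻²)/2` and `dr = 2 x⁻¹ dx`. -/
lemma map_expHalf_withDensity :
    ((lebesgueIci 0).withDensity fun r => ENNReal.ofReal (Real.sinh (r : ℝ) ^ 2)).map expHalf =
      (lebesgueIci 1).withDensity fun x => ENNReal.ofReal
        (2 * (((x : ℝ) ^ 2 - ((x : ℝ) ^ 2)⁻¹) / 2) ^ 2 * (x : ℝ)⁻¹) := by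
  have himg : (fun r : ℝ => Real.exp (r / 2)) '' Set.Ici 0 = Set.Ici 1 := by
    ext x
    constructor
    · rintro ⟨r, hr, rfl⟩
      exact (expHalf ⟨r, hr⟩).2
    · intro hx
      obtain ⟨r, hr⟩ := bijective_expHalf.2 ⟨x, hx⟩
      exact ⟨r, r.2, congrArg Subtype.val hr⟩
  refine Measure.ext_of_lintegral _ fun f hf => ?_
  have hd0 : Measurable fun r : Set.Ici (0 : ℝ) => ENNReal.ofReal (Real.sinh (r : ℝ) ^ 2) :=
    ((Real.measurable_sinh.comp measurable_subtype_coe).pow_const 2).ennreal_ofReal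
  have hd1 : Measurable fun x : Set.Ici (1 : ℝ) => ENNReal.ofReal
      (2 * (((x : ℝ) ^ 2 - ((x : ℝ) ^ 2)⁻¹) / 2) ^ 2 * (x : ℝ)⁻¹) :=
    (measurable_densityX.comp measurable_subtype_coe).ennreal_ofReal
  rw [lintegral_map hf continuous_expHalf.measurable, lintegral_withDensity_eq_lintegral_mul _ hd1 hf]
  refine (lintegral_withDensity_eq_lintegral_mul _ hd0
    (hf.comp continuous_expHalf.measurable)).trans ?_
  -- Extending `f` to the whole line makes the change of variables on `ℝ` applicable.
  set F : ℝ → ℝ≥0∞ := fun x => f (Set.projIci 1 x) with hF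
  have hFf : ∀ x : Set.Ici (1 : ℝ), f x = F x := fun x => by
    rw [hF]; simp only [Set.projIci_coe]
  have hl : ∀ r : Set.Ici (0 : ℝ), ((fun r : Set.Ici (0 : ℝ) =>
      ENNReal.ofReal (Real.sinh (r : ℝ) ^ 2)) * f ∘ expHalf) r =
      ENNReal.ofReal (Real.sinh (r : ℝ) ^ 2) * F (Real.exp ((r : ℝ) / 2)) := fun r => by
    rw [Pi.mul_apply, Function.comp_apply, hFf]; rfl
  have hr : ∀ x : Set.Ici (1 : ℝ), ((fun x : Set.Ici (1 : ℝ) => ENNReal.ofReal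
      (2 * (((x : ℝ) ^ 2 - ((x : ℝ) ^ 2)⁻¹) / 2) ^ 2 * (x : ℝ)⁻¹)) * f) x =
      ENNReal.ofReal (2 * (((x : ℝ) ^ 2 - ((x : ℝ) ^ 2)⁻¹) / 2) ^ 2 * (x : ℝ)⁻¹) * F x :=
    fun x => by rw [Pi.mul_apply, hFf]
  refine (lintegral_congr hl).trans (Eq.trans ?_ (lintegral_congr hr).symm)
  rw [lintegral_lebesgueIci 0 fun r => ENNReal.ofReal (Real.sinh r ^ 2) * F (Real.exp (r / 2)),
    lintegral_lebesgueIci 1 fun x => ENNReal.ofReal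
      (2 * ((x ^ 2 - (x ^ 2)⁻¹) / 2) ^ 2 * x⁻¹) * F x, ← himg,
    lintegral_image_eq_lintegral_abs_deriv_mul measurableSet_Ici
      (fun x _ => ((hasDerivAt_id' x).div_const 2).exp.hasDerivWithinAt)]
  · refine setLIntegral_congr_fun measurableSet_Ici fun r hr => ?_
    have he := Real.exp_pos (r / 2)
    have h2 : Real.exp (r / 2) ^ 2 = Real.exp r := by
      rw [← Real.exp_nat_mul]; congr 1; push_cast; ring
    rw [← mul_assoc, ← ENNReal.ofReal_mul (abs_nonneg _), abs_of_pos (by positivity), h2,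
      ← Real.exp_neg, ← Real.sinh_eq]
    congr 2
    field_simp
  · intro x _ y _ h
    have h := Real.exp_injective h
    linarith

/-- Both densities depend on the middle coordinate alone, so they move onto that factor and the
claim becomes one-dimensional. -/
lemma map_expHalf_cartanMeasure (μ μ' : Measure SU2) [SFinite μ] [SFinite μ'] :
    (cartanMeasure μ μ').map (Prod.map id (Prod.map expHalf id)) = cartanMeasureX μ μ' := by
  have hd0 : Measurable fun r : Set.Ici (0 : ℝ) => ENNReal.ofReal (Real.sinh (r : ℝ) ^ 2) :=
    ((Real.measurable_sinh.comp measurable_subtype_coe).pow_const 2).ennreal_ofReal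
  have hd1 : Measurable fun x : Set.Ici (1 : ℝ) => ENNReal.ofReal
      (2 * (((x : ℝ) ^ 2 - ((x : ℝ) ^ 2)⁻¹) / 2) ^ 2 * (x : ℝ)⁻¹) :=
    (measurable_densityX.comp measurable_subtype_coe).ennreal_ofReal
  have h0 : cartanMeasure μ μ' = μ.prod (((lebesgueIci 0).withDensity
      fun r => ENNReal.ofReal (Real.sinh (r : ℝ) ^ 2)).prod μ') := by
    rw [prod_withDensity_left hd0, prod_withDensity_right (by exact hd0.comp measurable_fst)]
    rfl
  have h1 : cartanMeasureX μ μ' = μ.prod (((lebesgueIci 1).withDensity fun x => ENNReal.ofReal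
      (2 * (((x : ℝ) ^ 2 - ((x : ℝ) ^ 2)⁻¹) / 2) ^ 2 * (x : ℝ)⁻¹)).prod μ') := by
    rw [prod_withDensity_left hd1, prod_withDensity_right (by exact hd1.comp measurable_fst)]
    rfl
  have hm := continuous_expHalf.measurable
  rw [h0, h1, ← Measure.map_prod_map _ _ measurable_id (hm.prodMap measurable_id),
    ← Measure.map_prod_map _ _ hm measurable_id, map_expHalf_withDensity, Measure.map_id,
    Measure.map_id]

lemma map_kakx_cartanMeasureX (μ μ' : Measure SU2) [SFinite μ] [SFinite μ'] :
    (cartanMeasureX μ μ').map kakx = (cartanMeasure μ μ').map kak := by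
  rw [← map_expHalf_cartanMeasure, Measure.map_map continuous_kakx.measurable
    (measurable_id.prodMap (continuous_expHalf.measurable.prodMap measurable_id))]
  congr 1
  funext p
  exact kakx_expHalf p

/-- Integration against a multiple of the image of a measure with density. -/
lemma integral_smul_map_withDensity {X Y : Type*} [MeasurableSpace X] [MeasurableSpace Y]
    (m : Measure X) {d : X → ℝ} (hd : Measurable d) (hd0 : ∀ x, 0 ≤ d x) {T : X → Y}
    (hT : Measurable T) {c : ℝ} (hc : 0 < c) {f : Y → ℝ} (hf : Measurable f) {ν : Measure Y}
    (hν : ν = ENNReal.ofReal c • (m.withDensity fun x => ENNReal.ofReal (d x)).map T) :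
    (Integrable f ν ↔ Integrable (fun x => d x * f (T x)) m) ∧
      ∫ y, f y ∂ν = c * ∫ x, d x * f (T x) ∂m := by
  have hr : ∀ x, (ENNReal.ofReal (d x)).toReal = d x := fun x => ENNReal.toReal_ofReal (hd0 x)
  have hlt : ∀ᵐ x ∂m, ENNReal.ofReal (d x) < ∞ := ae_of_all _ fun _ => ENNReal.ofReal_lt_top
  subst hν
  constructor
  · rw [integrable_smul_measure (by simpa using hc) ENNReal.ofReal_ne_top,
      integrable_map_measure hf.aestronglyMeasurable hT.aemeasurable,
      integrable_withDensity_iff_integrable_smul' hd.ennreal_ofReal hlt]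
    simp only [hr, smul_eq_mul, Function.comp_apply]
  · rw [integral_smul_measure, integral_map hT.aemeasurable hf.aestronglyMeasurable,
      integral_withDensity_eq_integral_toReal_smul hd.ennreal_ofReal hlt, ENNReal.toReal_ofReal hc.le]
    simp only [hr, smul_eq_mul]

/-! ### The differential of the parametrisation -/

lemma cartanA_inv (r : ℝ) : (cartanA r)⁻¹ = cartanA (-r) := by
  rw [inv_eq_iff_mul_eq_one, ← cartanA_add, add_neg_cancel, cartanA_zero]

/-- The factors `e^{∓r} = cosh r ∓ sinh r` off the diagonal are the source of the hyperbolic entries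
of the differential. -/
lemma cartanA_conj (r : ℝ) (X : M2) : ((cartanA r)⁻¹ : SL2C).1 * X * (cartanA r).1 =
    !![X 0 0, ((Real.exp (-r) : ℝ) : ℂ) * X 0 1; ((Real.exp r : ℝ) : ℂ) * X 1 0, X 1 1] := by
  rw [cartanA_inv]
  have h1 : Real.exp (-r / 2) * Real.exp (r / 2) = 1 := by
    rw [← Real.exp_add, Real.exp_eq_one_iff]; ring
  have h2 : Real.exp (-r / 2) * Real.exp (-(r / 2)) = Real.exp (-r) := by
    rw [← Real.exp_add]; congr 1; ring
  have h3 : Real.exp (-(-r / 2)) * Real.exp (r / 2) = Real.exp r := by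
    rw [← Real.exp_add]; congr 1; ring
  have h4 : Real.exp (-(-r / 2)) * Real.exp (-(r / 2)) = 1 := by
    rw [← Real.exp_add, Real.exp_eq_one_iff]; ring
  rw [← h2, ← h3]
  have h1 := congrArg Complex.ofReal h1
  have h4 := congrArg Complex.ofReal h4
  rw [Complex.ofReal_mul, Complex.ofReal_one] at h1 h4
  rw [Complex.ofReal_mul, Complex.ofReal_mul]
  ext i j
  fin_cases i <;> fin_cases j <;>
    simp only [cartanA, Matrix.mul_apply, Fin.sum_univ_two, of_apply, cons_val', cons_val_zero,
      cons_val_one, cons_val_fin_one, Fin.zero_eta, Fin.mk_one, zero_mul, mul_zero, add_zero,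
      zero_add]
  · linear_combination X 0 0 * h1
  · ring
  · ring
  · linear_combination X 1 1 * h4

/-- The differential of `phi r` at `0`, as a linear map. -/
noncomputable def dphiLin (r : ℝ) : (su2 × diagA × su2) →ₗ[ℝ] sl2 where
  toFun p := ⟨((cartanA r)⁻¹ : SL2C).1 * p.1.1 * (cartanA r).1 + p.2.1.1 + p.2.2.1, by
    have h1 : Matrix.trace p.1.1 = 0 := p.1.2.2
    refine add_mem (add_mem ?_ p.2.1.2.2) p.2.2.2.2
    change Matrix.trace _ = 0
    rw [cartanA_conj, trace_fin_two, ← h1, trace_fin_two]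
    rfl⟩
  map_add' p q := by
    apply Subtype.ext
    simp only [Prod.fst_add, Prod.snd_add, Submodule.coe_add, mul_add, add_mul]
    abel
  map_smul' c p := by
    apply Subtype.ext
    simp [smul_add]

instance : FiniteDimensional ℝ (su2 × diagA × su2) := Module.Finite.of_basis domBasis

/-- The differential of `phi r` at `0`. -/
noncomputable def dphi (r : ℝ) : (su2 × diagA × su2) →L[ℝ] sl2 :=
  LinearMap.toContinuousLinearMap (dphiLin r)

lemma hasFDerivAt_phi (r : ℝ) : HasFDerivAt (phi r) (sl2.subtypeL ∘L dphi r) 0 := by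
  -- The norm is auxiliary: it serves the derivative of `exp` and the product rule, while the
  -- differential depends on the topology only.
  let _ : NormedRing M2 := Matrix.linftyOpNormedRing
  let _ : NormedAlgebra ℝ M2 := Matrix.linftyOpNormedAlgebra
  have hexp : HasFDerivAt (NormedSpace.exp : M2 → M2) (1 : M2 →L[ℝ] M2) 0 := hasFDerivAt_exp_zero
  have key : ∀ L : (su2 × diagA × su2) →L[ℝ] M2,
      HasFDerivAt (fun p => NormedSpace.exp (L p)) L 0 := fun L => by
    have h0 : HasFDerivAt (NormedSpace.exp : M2 → M2) (1 : M2 →L[ℝ] M2) (L 0) := by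
      rw [map_zero]; exact hexp
    exact h0.comp 0 L.hasFDerivAt
  have e1 := key (su2.subtypeL ∘L ContinuousLinearMap.fst ℝ su2 (diagA × su2))
  have e2 := key (diagA.subtypeL ∘L ContinuousLinearMap.fst ℝ diagA su2 ∘L
    ContinuousLinearMap.snd ℝ su2 (diagA × su2))
  have e3 := key (su2.subtypeL ∘L ContinuousLinearMap.snd ℝ diagA su2 ∘L
    ContinuousLinearMap.snd ℝ su2 (diagA × su2))
  have h := (((e1.const_mul ((cartanA r)⁻¹ : SL2C).1).mul_const' (cartanA r).1).mul' e2).mul' e3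
  have hA : ((cartanA r)⁻¹ : SL2C).1 * (cartanA r).1 = 1 := by
    rw [← SL2C_mul_val, inv_mul_cancel]; rfl
  refine h.congr_fderiv ?_
  refine ContinuousLinearMap.ext fun p => ?_
  change ((cartanA r)⁻¹ : SL2C).1 * NormedSpace.exp (0 : M2) * (cartanA r).1 *
      NormedSpace.exp (0 : M2) * p.2.2.1 + (((cartanA r)⁻¹ : SL2C).1 * NormedSpace.exp (0 : M2) *
      (cartanA r).1 * p.2.1.1 + ((cartanA r)⁻¹ : SL2C).1 * p.1.1 * (cartanA r).1 *
      NormedSpace.exp (0 : M2)) * NormedSpace.exp (0 : M2) =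
    ((cartanA r)⁻¹ : SL2C).1 * p.1.1 * (cartanA r).1 + p.2.1.1 + p.2.2.1
  simp only [NormedSpace.exp_zero, mul_one, hA, one_mul]
  abel

lemma toMatrix_dphi (r : ℝ) : LinearMap.toMatrix domBasis codBasis (dphi r : _ →ₗ[ℝ] sl2) =
    !![ Real.cosh r, 1, 0, 0, 0, 0, 0;
       -Real.sinh r, 0, 0, 0, 0, 0, 0;
        0, 0, Real.cosh r, 1, 0, 0, 0;
        0, 0, Real.sinh r, 0, 0, 0, 0;
        0, 0, 0, 0, 1, 1, 0;
        0, 0, 0, 0, 0, 0, 1] := by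
  -- Comparing the linear maps on basis vectors avoids computing coordinates in `codBasis`.
  rw [← LinearEquiv.eq_symm_apply, LinearMap.toMatrix_symm]
  refine domBasis.ext fun j => ?_
  rw [Matrix.toLin_self]
  simp only [codBasis, domBasis, Module.Basis.mk_apply]
  apply Subtype.ext
  have hD : ∀ p, ((dphi r p : sl2) : M2) =
    ((cartanA r)⁻¹ : SL2C).1 * p.1.1 * (cartanA r).1 + p.2.1.1 + p.2.2.1 := fun _ => rfl
  simp only [ContinuousLinearMap.coe_coe, hD, cartanA_conj, Fin.sum_univ_succ]
  have h1 : Complex.exp (-r) = (Real.cosh r : ℂ) - (Real.sinh r : ℂ) := by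
    rw [← Complex.ofReal_sub, Real.cosh_sub_sinh, Complex.ofReal_exp, Complex.ofReal_neg]
  have h2 : Complex.exp r = (Real.cosh r : ℂ) + (Real.sinh r : ℂ) := by
    rw [← Complex.ofReal_add, Real.cosh_add_sinh, Complex.ofReal_exp]
  fin_cases j <;> ext i k <;> fin_cases i <;> fin_cases k <;>
    simp [domVec, codVec, kx, ky, kz, az, σx, σy, σz, -Complex.ofReal_cosh, -Complex.ofReal_sinh]
  · linear_combination h1
  · linear_combination -h2
  · linear_combination Complex.I * h1
  · linear_combination Complex.I * h2

/-- The columns with indices `4` and `5` (counted from zero) coincide, so a minor containing both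
vanishes. Removing one of them leaves a block diagonal matrix with blocks of determinant `s`, `-s`
and `1`. -/
lemma abs_maxMinor (c s : ℝ) (j : Fin 7) :
    |maxMinor !![ c, 1, 0, 0, 0, 0, 0;
       -s, 0, 0, 0, 0, 0, 0;
        0, 0, c, 1, 0, 0, 0;
        0, 0, s, 0, 0, 0, 0;
        0, 0, 0, 0, 1, 1, 0;
        0, 0, 0, 0, 0, 0, 1] j| = if j = 4 ∨ j = 5 then s ^ 2 else 0 := by
  unfold maxMinor
  fin_cases j
  all_goals
    iterate 6
      try
        rw [det_succ_row_zero]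
        simp [Fin.sum_univ_succ, Fin.succAbove]
  all_goals
    erw [det_fin_two]
    simp [Fin.succAbove, sq]

end CartanSL2

theorem mainTheorem2 :
    -- `SL(2, ℂ) = SU(2) · A⁺ · SU(2)`
    Function.Surjective kak ∧
    -- `A_x = A_r` for `x = e^{r/2}`, and this substitution is a bijection `[0, ∞) → [1, ∞)`
    (Function.Bijective expHalf ∧ ∀ r : Set.Ici (0 : ℝ), cartanAx (expHalf r) = cartanA r) ∧
    -- the Haar measure of `SL(2, ℂ)` in the coordinates `(k, r, k')` and `(k, x, k')`
    (∀ μ μ' : Measure SU2, μ.IsHaarMeasure → μ'.IsHaarMeasure →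
      ((cartanMeasure μ μ').map kak).IsHaarMeasure ∧
      ((cartanMeasure μ μ').map kak).IsMulRightInvariant ∧
      (cartanMeasureX μ μ').map kakx = (cartanMeasure μ μ').map kak ∧
      (cartanMeasure μ μ').map (Prod.map id (Prod.map expHalf id)) = cartanMeasureX μ μ' ∧
      ∀ μG : Measure SL2C, μG.IsHaarMeasure →
        ∃ c : ℝ, 0 < c ∧
          μG = ENNReal.ofReal c • (cartanMeasure μ μ').map kak ∧
          ∀ f : SL2C → ℝ, Measurable f →
            (Integrable f μG ↔
              Integrable (fun p : SU2 × Set.Ici (0 : ℝ) × SU2 =>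
                Real.sinh (p.2.1 : ℝ) ^ 2 * f (toSL p.1 * cartanA p.2.1 * toSL p.2.2))
                (μ.prod ((lebesgueIci 0).prod μ'))) ∧
            (∫ g, f g ∂μG =
              c * ∫ p : SU2 × Set.Ici (0 : ℝ) × SU2,
                Real.sinh (p.2.1 : ℝ) ^ 2 * f (toSL p.1 * cartanA p.2.1 * toSL p.2.2)
                ∂(μ.prod ((lebesgueIci 0).prod μ'))) ∧
            (Integrable f μG ↔
              Integrable (fun p : SU2 × Set.Ici (1 : ℝ) × SU2 =>
                2 * (((p.2.1 : ℝ) ^ 2 - ((p.2.1 : ℝ) ^ 2)⁻¹) / 2) ^ 2 * (p.2.1 : ℝ)⁻¹ *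
                  f (toSL p.1 * cartanAx p.2.1 * toSL p.2.2))
                (μ.prod ((lebesgueIci 1).prod μ'))) ∧
            (∫ g, f g ∂μG =
              c * ∫ p : SU2 × Set.Ici (1 : ℝ) × SU2,
                2 * (((p.2.1 : ℝ) ^ 2 - ((p.2.1 : ℝ) ^ 2)⁻¹) / 2) ^ 2 * (p.2.1 : ℝ)⁻¹ *
                  f (toSL p.1 * cartanAx p.2.1 * toSL p.2.2)
                ∂(μ.prod ((lebesgueIci 1).prod μ')))) ∧
    -- the differential at `0` of the parametrisation, its matrix and its maximal minors
    (∀ r : ℝ, ∃ D : (su2 × diagA × su2) →L[ℝ] sl2,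
      HasFDerivAt (phi r) (sl2.subtypeL ∘L D) 0 ∧
      LinearMap.toMatrix domBasis codBasis (D : (su2 × diagA × su2) →ₗ[ℝ] sl2) =
        !![ Real.cosh r, 1, 0, 0, 0, 0, 0;
           -Real.sinh r, 0, 0, 0, 0, 0, 0;
            0, 0, Real.cosh r, 1, 0, 0, 0;
            0, 0, Real.sinh r, 0, 0, 0, 0;
            0, 0, 0, 0, 1, 1, 0;
            0, 0, 0, 0, 0, 0, 1] ∧
      ∀ j : Fin 7,
        |maxMinor (LinearMap.toMatrix domBasis codBasis
            (D : (su2 × diagA × su2) →ₗ[ℝ] sl2)) j| =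
          if j = 4 ∨ j = 5 then Real.sinh r ^ 2 else 0) := by
  refine ⟨kak_surjective, ⟨bijective_expHalf, cartanAx_expHalf⟩, fun μ μ' hμ hμ' => ?_, fun r =>
    ⟨dphi r, hasFDerivAt_phi r, toMatrix_dphi r, fun j => ?_⟩⟩
  · obtain ⟨c₀, hc0, hc1, hmap⟩ := exists_map_kak_eq_smul_shellMeasure μ μ'
    have hH : ((cartanMeasure μ μ').map kak).IsHaarMeasure := by
      rw [hmap]
      exact Measure.IsHaarMeasure.smul _ hc0 hc1
    have hR : ((cartanMeasure μ μ').map kak).IsMulRightInvariant := by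
      rw [hmap]
      infer_instance
    refine ⟨hH, hR, map_kakx_cartanMeasureX μ μ', map_expHalf_cartanMeasure μ μ', fun μG hG => ?_⟩
    -- Uniqueness of Haar measure up to scaling provides the constant `c`.
    have hG' := Measure.isMulLeftInvariant_eq_smul μG ((cartanMeasure μ μ').map kak)
    have hpos := Measure.haarScalarFactor_pos_of_isHaarMeasure μG ((cartanMeasure μ μ').map kak)
    set c := Measure.haarScalarFactor μG ((cartanMeasure μ μ').map kak)
    have hν : μG = ENNReal.ofReal (c : ℝ) • (cartanMeasure μ μ').map kak := by
      rw [ENNReal.ofReal_coe_nnreal]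
      exact hG'
    have hνx : μG = ENNReal.ofReal (c : ℝ) • (cartanMeasureX μ μ').map kakx := by
      rw [map_kakx_cartanMeasureX]
      exact hν
    have hc : (0 : ℝ) < c := NNReal.coe_pos.2 hpos
    refine ⟨c, hc, hν, fun f hf => ?_⟩
    have h1 := integral_smul_map_withDensity (μ.prod ((lebesgueIci 0).prod μ'))
      (d := fun p => Real.sinh (p.2.1 : ℝ) ^ 2)
      ((Real.measurable_sinh.comp (by fun_prop)).pow_const 2)
      (fun p => sq_nonneg _) continuous_kak.measurable hc hf hν
    have h2 := integral_smul_map_withDensity (μ.prod ((lebesgueIci 1).prod μ'))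
      (d := fun p => 2 * (((p.2.1 : ℝ) ^ 2 - ((p.2.1 : ℝ) ^ 2)⁻¹) / 2) ^ 2 * (p.2.1 : ℝ)⁻¹)
      (measurable_densityX.comp (measurable_subtype_coe.comp (measurable_fst.comp measurable_snd)))
      (fun p => mul_nonneg (by positivity) (inv_nonneg.2 (zero_le_one.trans p.2.1.2)))
      continuous_kakx.measurable hc hf hνx
    exact ⟨h1.1, h1.2, h2.1, h2.2⟩
  · rw [toMatrix_dphi]
    exact abs_maxMinor _ _ j
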